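/- Let $L>0$ and let $q\in L_2[0,L]$ be complex valued. For $\rho\in\mathbb C$ let $S(\rho,x)$, $0\le x\le L$, be the solution of $-y''+q(x)y=\rho^2y$ on $(0,L)$ with $S(\rho,0)=0$, $S'(\rho,0)=1$ (that is, $S(\rho,\cdot)$ is differentiable, $S'(\rho,\cdot)$ is absolutely continuous on $[0,L]$, and the equation holds almost everywhere). For $N\in\mathbb N$ let $$S_N(\rho,L)=\frac{\sin(\rho L)}{\rho}+\frac{1}{2\rho\sin(\rho L)}\sum_{n=0}^{N-1}s_n(L)\left(\operatorname{sinc}\left(\frac{2\rho L}{\pi}-2n-1\right)+\operatorname{sinc}\left(\frac{2\rho L}{\pi}+2n+1\right)\right),$$ $$s_n(L)=\frac{(-1)^n(2n+1)\pi}{L}\,S\left(\frac{(2n+1)\pi}{2L},L\right)-2,$$ where $\operatorname{sinc}(z)=\frac{\sin(\pi z)}{\pi z}$ for $z\ne0$ and $\operatorname{sinc}(0)=1$; at the points where $\rho\sin(\rho L)=0$ the value $S_N(\rho,L)$ is defined as the limit of the formula. **Theorem.** The functions $S(\cdot,L)$ and $S_N(\cdot,L)$, $N\in\mathbb N$, are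 entire. For every $\varepsilon>0$ there is $N_0\in\mathbb N$ such that for every $N\ge N_0$ there is a bijection between the zeros of $S(\cdot,L)$ in $\mathbb C$ and the zeros of $S_N(\cdot,L)$ in $\mathbb C$, all zeros being counted with multiplicity, such that corresponding zeros $\rho$ and $\rho'$ satisfy $|\rho-\rho'|\le\varepsilon$. In particular, every zero of $S(\cdot,L)$ is approximated by a corresponding zero of $S_N(\cdot,L)$ with error at most $\varepsilon$, and $S_N(\cdot,L)$ has no other zeros. -/

import Mathlib

open MeasureTheory Filter Topology Set

/-- The normalized cardinal sine of a complex variable. -/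
noncomputable def csinc (z : ℂ) : ℂ :=
  if z = 0 then 1 else Complex.sin (Real.pi * z) / (Real.pi * z)

/-- `y` is the solution of `-y'' + q y = ρ² y` on `[0, L]` with `y(0) = 0`, `y'(0) = 1`, in the
usual (Carathéodory) sense for an integrable potential: `y` is differentiable on `[0, L]` (one-sided
at the end points), `v = y'` is absolutely continuous on `[0, L]`, and the equation holds almost
everywhere. -/
def IsSineSolution (q : ℝ → ℂ) (L : ℝ) (ρ : ℂ) (y : ℝ → ℂ) : Prop :=
  ∃ v : ℝ → ℂ,
    (∀ x ∈ Icc (0 : ℝ) L, HasDerivWithinAt y (v x) (Icc (0 : ℝ) L) x) ∧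
    AbsolutelyContinuousOnInterval v 0 L ∧
    (∀ᵐ x ∂(volume.restrict (Ioo (0 : ℝ) L)),
      ∃ w : ℂ, HasDerivAt v w x ∧ -w + q x * y x = ρ ^ 2 * y x) ∧
    y 0 = 0 ∧ v 0 = 1

/-- `S(ρ, x)`, for `0 ≤ x ≤ L`: the value at `x` of the solution singled out by `IsSineSolution`
(for `q ∈ L₂[0, L]` such a solution exists, and it is unique on `[0, L]`). -/
noncomputable def solS (q : ℝ → ℂ) (L : ℝ) (ρ : ℂ) (x : ℝ) : ℂ :=
  Classical.epsilon (fun y : ℝ → ℂ => IsSineSolution q L ρ y) x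

/-- `sₙ(x) = (-1)ⁿ (2n+1) (π / x) S((2n+1)π / (2x), x) - 2`. -/
noncomputable def cardinalCoeff (q : ℝ → ℂ) (L : ℝ) (n : ℕ) (x : ℝ) : ℂ :=
  (-1) ^ n * (2 * n + 1) * Real.pi / x *
    solS q L ((2 * n + 1) / (2 * x) * Real.pi) x - 2

/-- The closed formula for the truncated cardinal series; it is meaningful as it stands wherever
`ρ sin(ρ x) ≠ 0`. -/
noncomputable def truncSFormula (q : ℝ → ℂ) (L : ℝ) (N : ℕ) (ρ : ℂ) (x : ℝ) : ℂ :=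
  Complex.sin (ρ * x) / ρ +
    1 / (2 * ρ * Complex.sin (ρ * x)) *
      ∑ n ∈ Finset.range N, cardinalCoeff q L n x *
        (csinc (2 * ρ * x / Real.pi - 2 * n - 1) + csinc (2 * ρ * x / Real.pi + 2 * n + 1))

open Classical in
/-- The truncated cardinal series `S_N(ρ, x)`: the closed formula, with the removable singularities
at the points where `ρ sin(ρ x) = 0` filled in by taking the limit. -/
noncomputable def truncS (q : ℝ → ℂ) (L : ℝ) (N : ℕ) (ρ : ℂ) (x : ℝ) : ℂ :=
  if ρ * Complex.sin (ρ * x) = 0 then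
    limUnder (𝓝[≠] ρ) (fun z : ℂ => truncSFormula q L N z x)
  else truncSFormula q L N ρ x

/-- The zeros of a complex function, each listed as often as its multiplicity: a zero `z` of order
`m` gives the pairs `(z, 0), …, (z, m - 1)`. -/
def ZeroWithMultiplicity (f : ℂ → ℂ) : Type :=
  {p : ℂ × ℕ // (p.2 : ℕ∞) < analyticOrderAt f p.1}

/-- The location of a zero listed with multiplicity. -/
def ZeroWithMultiplicity.point {f : ℂ → ℂ} (p : ZeroWithMultiplicity f) : ℂ := p.1.1

/-! Write `K(ρ) = sin(ρL)/ρ`. The equation is equivalent to a Volterra integral equation, which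
shows that `S(ρ, L)` is entire and even in `ρ` and that `d = S - K` is `O(exp(|im ρ| L) / (1 +
|ρ|)²)`.

In the variable `z = ρL`, the truncated series is `K` plus the `N`-th partial sum of the
interpolation series of `d` at the zeros `±a_n` of the cosine, with basis functions `cos z / (z² -
a_n²)` (`csinc_add_csinc`, `mul_cardinalCoeff`). The full series equals `d`: the difference is
entire, vanishes at every zero of the cosine, and is too small at infinity to be nonzero
(`eq_zero_of_vanishing_at_cos_zeros`). Its tail is at most `δ exp(|im z|) / (1 + |z|)` on the whole
plane once `N` is large (`exists_norm_sub_cardinalSum_le`).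

This weight is also the size of `S` from below: away from small discs around `kπ/L`, and for large
`|ρ|`, `|S|` is at least a constant times `exp(|im ρ| L) / (1 + |ρ|)`. Hence a single `N₀` makes `|S
- S_N| < |S|` outside a family of disjoint small discs: infinitely many around the far points `kπ/L`
and finitely many around the remaining zeros of `S`. Rouché's theorem on each disc and gluing over
the family give the bijection (`exists_stability_zeros_of_sine_asymptotics`,
`exists_equiv_zeroWithMultiplicity`). -/

/-! ### Argument principle, Rouché's theorem, and matching of zeros. -/

/-- An entire function is divisible by `(z - a) ^ n` when it vanishes at `a` to order `n`. -/
theorem Differentiable.exists_eq_pow_mul_of_analyticOrderAt {a : ℂ} {n : ℕ} {f : ℂ → ℂ}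
    (hf : Differentiable ℂ f) (h : analyticOrderAt f a = n) :
    ∃ g : ℂ → ℂ, Differentiable ℂ g ∧ g a ≠ 0 ∧ ∀ z, f z = (z - a) ^ n * g z := by
  induction n generalizing f with
  | zero =>
    refine ⟨f, hf, ?_, fun z => by simp⟩
    exact (hf.analyticAt a).analyticOrderAt_eq_zero.1 (by simp [h])
  | succ n ih =>
    have hfa : f a = 0 := by
      by_contra hne
      have := (hf.analyticAt a).analyticOrderAt_eq_zero.2 hne
      rw [this] at h
      exact absurd h (by norm_cast)
    have hg : Differentiable ℂ (dslope f a) := fun z =>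
      ((Complex.differentiableOn_dslope (s := univ) (c := a) univ_mem).2
        hf.differentiableOn).differentiableAt univ_mem
    have hfg : ∀ z, f z = (z - a) * dslope f a z := fun z => by
      have := sub_smul_dslope f a z
      simp only [smul_eq_mul, hfa, sub_zero] at this
      exact this.symm
    have hord : analyticOrderAt (dslope f a) a = n := by
      have h1 : f = (fun z => z - a) * dslope f a := funext hfg
      have h2 : analyticOrderAt (fun z : ℂ => z - a) a = 1 := by
        have : AnalyticAt ℂ (fun z : ℂ => z - a) a := by fun_prop
        have := (this.analyticOrderAt_eq_natCast (n := 1)).2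
          ⟨fun _ => 1, analyticAt_const, one_ne_zero, by simp⟩
        exact_mod_cast this
      rw [h1, analyticOrderAt_mul (by fun_prop) (hg.analyticAt a), h2] at h
      push_cast at h
      rw [add_comm] at h
      exact ENat.add_left_injective_of_ne_top (n := 1) (by simp) h
    obtain ⟨g, hg1, hg2, hg3⟩ := ih hg hord
    refine ⟨g, hg1, hg2, fun z => ?_⟩
    rw [hfg, hg3]; ring

/-- A nonzero entire function has finitely many zeros in a compact set. -/
theorem Differentiable.finite_zeros_of_isCompact {f : ℂ → ℂ} (hf : Differentiable ℂ f)
    {w : ℂ} (hw : f w ≠ 0) {K : Set ℂ} (hK : IsCompact K) : {z ∈ K | f z = 0}.Finite := by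
  by_contra hinf
  obtain ⟨x, -, hx⟩ := Set.Infinite.exists_accPt_of_subset_isCompact hinf hK (sep_subset _ _)
  have hfreq : ∃ᶠ z in 𝓝[≠] x, f z = 0 := by
    rw [accPt_iff_frequently_nhdsNE] at hx
    exact hx.mono fun z hz => hz.2
  have := AnalyticOnNhd.eqOn_zero_of_preconnected_of_frequently_eq_zero
    (f := f) (U := univ) (fun z _ => hf.analyticAt z) isPreconnected_univ (mem_univ x) hfreq
  exact hw (this (mem_univ w))

theorem Differentiable.analyticOrderAt_ne_top {f : ℂ → ℂ} (hf : Differentiable ℂ f)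
    {w : ℂ} (hw : f w ≠ 0) (z : ℂ) : analyticOrderAt f z ≠ ⊤ := by
  intro h
  rw [analyticOrderAt_eq_top] at h
  have := AnalyticOnNhd.eqOn_zero_of_preconnected_of_eventuallyEq_zero
    (f := f) (U := univ) (fun z _ => hf.analyticAt z) isPreconnected_univ (mem_univ z) h
  exact hw (this (mem_univ w))

theorem Differentiable.continuousOn_logDeriv {f : ℂ → ℂ} (hf : Differentiable ℂ f)
    {s : Set ℂ} (hs : ∀ z ∈ s, f z ≠ 0) : ContinuousOn (logDeriv f) s := by
  intro z hz
  have h1 : ContinuousAt (_root_.deriv f) z := (hf.analyticAt z).deriv.continuousAt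
  exact (h1.div hf.continuous.continuousAt (hs z hz)).continuousWithinAt

/-- The argument principle for entire functions on a disc. -/
theorem circleIntegral_logDeriv_eq_sum {c : ℂ} {r : ℝ} (hr : 0 < r) (s : Finset ℂ) {f : ℂ → ℂ}
    (hf : Differentiable ℂ f) (hs : ∀ z ∈ Metric.closedBall c r, f z = 0 ↔ z ∈ s)
    (hsub : ∀ z ∈ s, z ∈ Metric.ball c r) {w : ℂ} (hw : f w ≠ 0) :
    (∮ z in C(c, r), logDeriv f z) =
      2 * Real.pi * Complex.I * ((∑ a ∈ s, analyticOrderNatAt f a : ℕ) : ℂ) := by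
  classical
  induction s using Finset.induction_on generalizing f with
  | empty =>
    simp only [Finset.sum_empty, Nat.cast_zero, mul_zero]
    have hne : ∀ z ∈ Metric.closedBall c r, f z ≠ 0 := fun z hz h0 => by
      simpa using (hs z hz).1 h0
    refine Complex.circleIntegral_eq_zero_of_differentiable_on_off_countable hr.le
      countable_empty (hf.continuousOn_logDeriv hne) fun z hz => ?_
    exact (hf.analyticAt z).deriv.differentiableAt.div (hf z)
      (hne z (Metric.ball_subset_closedBall hz.1))
  | insert a s has ih =>
    -- Dividing out the full power at `a` leaves an entire `g` whose zeros in the disc are exactly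
    -- `s`; the removed factor adds `n / (z - a)` to the logarithmic derivative.
    obtain ⟨g, hg, hga, hfg⟩ := hf.exists_eq_pow_mul_of_analyticOrderAt
      (ENat.natCast_toNat (hf.analyticOrderAt_ne_top hw a)).symm
    set n := (analyticOrderAt f a).toNat
    have hn : n ≠ 0 := by
      intro h0
      have := (hs a (Metric.ball_subset_closedBall (hsub a (by simp)))).2 (by simp)
      rw [hfg, h0] at this
      simp [hga] at this
    have hgz : ∀ z ∈ Metric.closedBall c r, g z = 0 ↔ z ∈ s := fun z hz => by
      have h1 := hs z hz
      rw [hfg, mul_eq_zero, pow_eq_zero_iff hn, sub_eq_zero, Finset.mem_insert] at h1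
      by_cases hza : z = a
      · subst hza; simp [hga, has]
      · simpa [hza] using h1
    have hgw : g w ≠ 0 := fun h => hw (by rw [hfg, h, mul_zero])
    have key := ih hg hgz (fun z hz => hsub z (by simp [hz])) hgw
    have hsne : ∀ z ∈ Metric.sphere c r, z ∉ insert a s := fun z hz hzs => by
      have := hsub z hzs
      rw [Metric.mem_sphere] at hz
      rw [Metric.mem_ball] at this
      linarith
    have hlog : EqOn (logDeriv f) (fun z => (n : ℂ) * (z - a)⁻¹ + logDeriv g z)
        (Metric.sphere c r) := fun z hz => by
      have hza : z - a ≠ 0 := fun h => hsne z hz (by simp [sub_eq_zero.1 h])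
      have hgz0 : g z ≠ 0 := fun h => hsne z hz
        (by simp [(hgz z (Metric.sphere_subset_closedBall hz)).1 h])
      have h1 : f = fun z => (z - a) ^ n * g z := funext hfg
      rw [h1, logDeriv_mul (f := fun z => (z - a) ^ n) z (pow_ne_zero _ hza) hgz0
        (by fun_prop) (hg z)]
      congr 1
      have := logDeriv_fun_pow (f := fun z : ℂ => z - a) (x := z) (by fun_prop) n
      rw [this]
      simp [logDeriv_apply, div_eq_mul_inv]
    have hsum : ∑ b ∈ s, analyticOrderNatAt f b = ∑ b ∈ s, analyticOrderNatAt g b := by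
      refine Finset.sum_congr rfl fun b hb => ?_
      have hba : b - a ≠ 0 := fun h => has (by rwa [← sub_eq_zero.1 h])
      have h1 : f = (fun z => (z - a) ^ n) * g := funext hfg
      have h2 : AnalyticAt ℂ (fun z : ℂ => (z - a) ^ n) b := by fun_prop
      unfold analyticOrderNatAt
      rw [h1, analyticOrderAt_mul h2 (hg.analyticAt b),
        h2.analyticOrderAt_eq_zero.2 (pow_ne_zero _ hba), zero_add]
    rw [circleIntegral.integral_congr hr.le hlog, circleIntegral.integral_add,
      circleIntegral.integral_const_mul, circleIntegral.integral_sub_inv_of_mem_ball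
        (hsub a (by simp)), key, Finset.sum_insert has, hsum]
    · change _ = 2 * (Real.pi : ℂ) * Complex.I * ((n + _ : ℕ) : ℂ)
      push_cast; ring
    · refine ContinuousOn.circleIntegrable hr.le (continuousOn_const.mul (ContinuousOn.inv₀
        (by fun_prop) fun z hz h => hsne z hz (by simp [sub_eq_zero.1 h])))
    · refine ContinuousOn.circleIntegrable hr.le (hg.continuousOn_logDeriv fun z hz h =>
        hsne z hz (by simp [(hgz z (Metric.sphere_subset_closedBall hz)).1 h]))

/-- The zeros in a disc counted with multiplicity, in terms of the integral of `f' / f`. -/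
theorem card_zeroWithMultiplicity_ball {c : ℂ} {r : ℝ} (hr : 0 < r) {f : ℂ → ℂ}
    (hf : Differentiable ℂ f) (hne : ∀ z ∈ Metric.sphere c r, f z ≠ 0) :
    Finite {p : ZeroWithMultiplicity f // p.point ∈ Metric.ball c r} ∧
    (∮ z in C(c, r), logDeriv f z) = 2 * Real.pi * Complex.I *
      (Nat.card {p : ZeroWithMultiplicity f // p.point ∈ Metric.ball c r} : ℂ) := by
  classical
  obtain ⟨w, hws⟩ : (Metric.sphere c r).Nonempty := NormedSpace.sphere_nonempty.2 hr.le
  have hw := hne w hws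
  have hfin := hf.finite_zeros_of_isCompact hw (isCompact_closedBall c r)
  set s := hfin.toFinset with hs
  have hmem : ∀ z ∈ Metric.closedBall c r, f z = 0 ↔ z ∈ s := fun z hz => by
    simp only [hs, Finite.mem_toFinset, mem_sep_iff]
    exact ⟨fun h => ⟨hz, h⟩, fun h => h.2⟩
  have hsub : ∀ z ∈ s, z ∈ Metric.ball c r := fun z hz => by
    simp only [hs, Finite.mem_toFinset, mem_sep_iff] at hz
    refine lt_of_le_of_ne hz.1 fun h => hne z h hz.2
  have hcast : ∀ a, ((analyticOrderNatAt f a : ℕ) : ℕ∞) = analyticOrderAt f a := fun a =>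
    ENat.natCast_toNat (hf.analyticOrderAt_ne_top hw a)
  let e : {p : ZeroWithMultiplicity f // p.point ∈ Metric.ball c r} ≃
      (a : s) × Fin (analyticOrderNatAt f a) :=
    { toFun := fun p => ⟨⟨p.1.point, by
          refine (hmem _ (Metric.ball_subset_closedBall p.2)).1 ?_
          by_contra h0
          have h1 := p.1.2
          change _ < analyticOrderAt f p.1.point at h1
          rw [(hf.analyticAt _).analyticOrderAt_eq_zero.2 h0] at h1
          simp at h1⟩, ⟨p.1.1.2, by
          have h1 := p.1.2
          rw [← hcast] at h1
          exact_mod_cast h1⟩⟩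
      invFun := fun x => ⟨⟨(x.1.1, x.2.1), by
          change ((x.2.1 : ℕ) : ℕ∞) < analyticOrderAt f x.1.1
          rw [← hcast]
          exact_mod_cast x.2.2⟩, hsub _ x.1.2⟩
      left_inv := fun p => rfl
      right_inv := fun x => rfl }
  refine ⟨Finite.of_equiv _ e.symm, ?_⟩
  rw [circleIntegral_logDeriv_eq_sum hr s hf hmem hsub hw, Nat.card_congr e,
    Nat.card_eq_fintype_card, Fintype.card_sigma]
  simp only [Fintype.card_fin]
  rw [Finset.sum_coe_sort s (fun a => analyticOrderNatAt f a)]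

/-- Rouché's theorem on a disc. -/
theorem card_zeroWithMultiplicity_ball_eq {c : ℂ} {r : ℝ} (hr : 0 < r) {f g : ℂ → ℂ}
    (hf : Differentiable ℂ f) (hg : Differentiable ℂ g)
    (h : ∀ z ∈ Metric.sphere c r, ‖g z - f z‖ < ‖f z‖) :
    Nonempty ({p : ZeroWithMultiplicity f // p.point ∈ Metric.ball c r} ≃
      {p : ZeroWithMultiplicity g // p.point ∈ Metric.ball c r}) := by
  have hfne : ∀ z ∈ Metric.sphere c r, f z ≠ 0 := fun z hz h0 => by
    have := h z hz
    rw [h0, norm_zero] at this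
    exact absurd this (norm_nonneg _).not_gt
  have hgne : ∀ z ∈ Metric.sphere c r, g z ≠ 0 := fun z hz h0 => by
    have := h z hz
    rw [h0, zero_sub, norm_neg] at this
    exact lt_irrefl _ this
  obtain ⟨hf1, hf2⟩ := card_zeroWithMultiplicity_ball hr hf hfne
  obtain ⟨hg1, hg2⟩ := card_zeroWithMultiplicity_ball hr hg hgne
  -- On the circle `|g/f - 1| < 1`, so the principal branch of `log (g/f)` is a primitive of the
  -- integrand.
  have hzero : (∮ z in C(c, r), (logDeriv g z - logDeriv f z)) = 0 := by
    refine circleIntegral.integral_eq_zero_of_hasDerivWithinAt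
      (f := fun z => Complex.log (g z / f z)) hr.le fun z hz => ?_
    have hf0 := hfne z hz
    have hg0 := hgne z hz
    have hslit : g z / f z ∈ Complex.slitPlane := by
      refine Complex.mem_slitPlane_of_norm_lt_one (z := g z / f z - 1) ?_ |> fun h => by simpa using h
      rw [div_sub_one hf0, norm_div, div_lt_one (norm_pos_iff.2 hf0)]
      exact h z hz
    have := ((hg z).hasDerivAt.div (hf z).hasDerivAt hf0).clog hslit
    refine (this.congr_deriv ?_).hasDerivWithinAt
    rw [logDeriv_apply, logDeriv_apply]
    simp only [Pi.div_apply]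
    field_simp
  rw [circleIntegral.integral_sub
    (ContinuousOn.circleIntegrable hr.le (hg.continuousOn_logDeriv hgne))
    (ContinuousOn.circleIntegrable hr.le (hf.continuousOn_logDeriv hfne)), hf2, hg2,
    sub_eq_zero] at hzero
  have h2 : (2 * Real.pi * Complex.I : ℂ) ≠ 0 := Complex.two_pi_I_ne_zero
  have := Nat.cast_injective (R := ℂ) (mul_left_cancel₀ h2 hzero)
  exact Finite.card_eq.1 this.symm

/-- If `‖g - f‖ < ‖f‖` outside a family of disjoint discs of radius at most `ε / 2`, the zeros of
`f` and `g` correspond to each other up to `ε`. -/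
theorem exists_equiv_zeroWithMultiplicity {ι : Type*} {c : ι → ℂ} {r : ι → ℝ} {ε : ℝ}
    (hr : ∀ i, 0 < r i) (hrε : ∀ i, r i ≤ ε / 2)
    (hd : Pairwise fun i j => Disjoint (Metric.closedBall (c i) (r i))
      (Metric.closedBall (c j) (r j)))
    {f g : ℂ → ℂ} (hf : Differentiable ℂ f) (hg : Differentiable ℂ g)
    (h : ∀ z, (∀ i, z ∉ Metric.ball (c i) (r i)) → ‖g z - f z‖ < ‖f z‖) :
    ∃ e : ZeroWithMultiplicity f ≃ ZeroWithMultiplicity g,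
      ∀ p : ZeroWithMultiplicity f, ‖p.point - (e p).point‖ ≤ ε := by
  have hzero : ∀ {φ : ℂ → ℂ} (_ : Differentiable ℂ φ) (p : ZeroWithMultiplicity φ),
      φ p.point = 0 := fun {φ} hφ p => by
    by_contra h0
    have h1 := p.2
    change _ < analyticOrderAt φ p.point at h1
    rw [(hφ.analyticAt _).analyticOrderAt_eq_zero.2 h0] at h1
    simp at h1
  have hmem : ∀ {φ : ℂ → ℂ} (_ : Differentiable ℂ φ)
      (_ : ∀ z, (∀ i, z ∉ Metric.ball (c i) (r i)) → φ z ≠ 0) (p : ZeroWithMultiplicity φ),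
      ∃ i, p.point ∈ Metric.ball (c i) (r i) := fun hφ hne p => by
    by_contra! h0
    exact hne _ h0 (hzero hφ p)
  have huniq : ∀ {z : ℂ} {i j : ι}, z ∈ Metric.ball (c i) (r i) → z ∈ Metric.ball (c j) (r j) →
      i = j := fun {z i j} hi hj => by
    by_contra hij
    exact disjoint_left.1 (hd hij) (Metric.ball_subset_closedBall hi)
      (Metric.ball_subset_closedBall hj)
  choose a ha using hmem (φ := f) hf fun z hz h0 => by
    have := h z hz
    rw [h0, norm_zero] at this
    exact absurd this (norm_nonneg _).not_gt
  choose b hb using hmem (φ := g) hg fun z hz h0 => by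
    have := h z hz
    rw [h0, zero_sub, norm_neg] at this
    exact lt_irrefl _ this
  have hcard : ∀ i, Nonempty ({p : ZeroWithMultiplicity f // p.point ∈ Metric.ball (c i) (r i)} ≃
      {p : ZeroWithMultiplicity g // p.point ∈ Metric.ball (c i) (r i)}) := fun i => by
    refine card_zeroWithMultiplicity_ball_eq (hr i) hf hg fun z hz => h z fun j hj => ?_
    by_cases hij : i = j
    · subst hij
      rw [Metric.mem_ball, Metric.mem_sphere.1 hz] at hj
      exact lt_irrefl _ hj
    · exact disjoint_left.1 (hd hij) (Metric.sphere_subset_closedBall hz)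
        (Metric.ball_subset_closedBall hj)
  let E := fun i => (hcard i).some
  -- By disjointness a point determines its disc, so the bijections of the single discs glue. `hE`
  -- and `hE'` change the disc index inside the dependent arguments.
  have hEa : ∀ p, a ((E (b p)).symm ⟨p, hb p⟩).1 = b p := fun p =>
    huniq (ha _) ((E (b p)).symm ⟨p, hb p⟩).2
  have hEb : ∀ p, b (E (a p) ⟨p, ha p⟩).1 = a p := fun p =>
    huniq (hb _) (E (a p) ⟨p, ha p⟩).2
  have hE : ∀ {i j : ι} (_ : i = j) (p : ZeroWithMultiplicity f) (hi) (hj),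
      (E i ⟨p, hi⟩).1 = (E j ⟨p, hj⟩).1 := by rintro i _ rfl p hi hj; rfl
  have hE' : ∀ {i j : ι} (_ : i = j) (p : ZeroWithMultiplicity g) (hi) (hj),
      ((E i).symm ⟨p, hi⟩).1 = ((E j).symm ⟨p, hj⟩).1 := by rintro i _ rfl p hi hj; rfl
  refine ⟨{ toFun := fun p => (E (a p) ⟨p, ha p⟩).1
            invFun := fun p => ((E (b p)).symm ⟨p, hb p⟩).1
            left_inv := fun p => ?_
            right_inv := fun p => ?_ }, fun p => ?_⟩
  · change ((E (b (E (a p) ⟨p, ha p⟩).1)).symm ⟨(E (a p) ⟨p, ha p⟩).1, hb _⟩).1 = p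
    rw [hE' (hEb p) _ _ (E (a p) ⟨p, ha p⟩).2]
    simp
  · change (E (a ((E (b p)).symm ⟨p, hb p⟩).1) ⟨((E (b p)).symm ⟨p, hb p⟩).1, ha _⟩).1 = p
    rw [hE (hEa p) _ _ ((E (b p)).symm ⟨p, hb p⟩).2]
    simp
  · have h1 : dist p.point (c (a p)) < r (a p) := ha p
    have h2 : dist (E (a p) ⟨p, ha p⟩).1.point (c (a p)) < r (a p) := (E (a p) ⟨p, ha p⟩).2
    have h3 := hrε (a p)
    rw [← dist_eq_norm]
    change dist p.point (E (a p) ⟨p, ha p⟩).1.point ≤ ε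
    have := dist_triangle_right p.point (E (a p) ⟨p, ha p⟩).1.point (c (a p))
    linarith

/-! ### Growth of sine and cosine, and a uniqueness theorem. -/

theorem Differentiable.dslope {f : ℂ → ℂ} (hf : Differentiable ℂ f) (a : ℂ) :
    Differentiable ℂ (dslope f a) := fun _ =>
  ((Complex.differentiableOn_dslope (s := univ) (c := a) univ_mem).2
    hf.differentiableOn).differentiableAt univ_mem

theorem Complex.norm_sin_le_exp (z : ℂ) : ‖Complex.sin z‖ ≤ Real.exp |z.im| := by
  rw [Complex.sin, norm_div, norm_mul, Complex.norm_I, mul_one, Complex.norm_ofNat]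
  have h1 := norm_sub_le (Complex.exp (-z * Complex.I)) (Complex.exp (z * Complex.I))
  rw [Complex.norm_exp, Complex.norm_exp] at h1
  have h2 : Real.exp ((-z * Complex.I).re) ≤ Real.exp |z.im| :=
    Real.exp_le_exp.2 (by simpa using le_abs_self z.im)
  have h3 : Real.exp ((z * Complex.I).re) ≤ Real.exp |z.im| :=
    Real.exp_le_exp.2 (by simpa using neg_le_abs z.im)
  rw [div_le_iff₀ two_pos]
  linarith

theorem Complex.norm_cos_le_exp (z : ℂ) : ‖Complex.cos z‖ ≤ Real.exp |z.im| := by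
  rw [← Complex.sin_add_pi_div_two]
  refine (Complex.norm_sin_le_exp _).trans_eq ?_
  have : ((Real.pi : ℂ) / 2).im = 0 := by
    rw [show (Real.pi : ℂ) / 2 = ((Real.pi / 2 : ℝ) : ℂ) by push_cast; ring, Complex.ofReal_im]
  rw [Complex.add_im, this, add_zero]

/-- Away from its zeros, the sine is comparable with `exp |im z|`. -/
theorem Complex.exists_le_norm_sin {r : ℝ} (hr : 0 < r) : ∃ c : ℝ, 0 < c ∧
    ∀ z : ℂ, (∀ k : ℤ, r ≤ ‖z - k * Real.pi‖) → c * Real.exp |z.im| ≤ ‖Complex.sin z‖ := by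
  have hpi := Real.pi_pos
  have hexp : Real.exp (-r) < 1 := by simpa using hr
  -- Two regimes. If `|im z| ≥ r/2`, use `|sin z| ≥ sinh |im z|`. Otherwise `re z` is at least `r/2`
  -- away from every `kπ`, and Jordan's inequality bounds `|sin (re z)|` below by `r/π`.
  refine ⟨min (r / (2 * Real.pi)) ((1 - Real.exp (-r)) / 2),
    lt_min (by positivity) (by linarith), fun z hz => ?_⟩
  have hsin : Complex.sin z = ⟨Real.sin z.re * Real.cosh z.im, Real.cos z.re * Real.sinh z.im⟩ := by
    rw [Complex.sin_eq, Complex.mk_eq_add_mul_I]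
    push_cast
    ring
  have hre : |Real.sin z.re| * Real.cosh z.im ≤ ‖Complex.sin z‖ := by
    have := Complex.abs_re_le_norm (Complex.sin z)
    rw [hsin] at this ⊢
    simpa [abs_mul, abs_of_pos (Real.cosh_pos _)] using this
  have hcosh : Real.exp |z.im| / 2 ≤ Real.cosh z.im := by
    rw [← Real.cosh_abs, Real.cosh_eq]
    have := Real.exp_pos (-|z.im|)
    linarith
  have hE := Real.exp_pos |z.im|
  by_cases hy : r / 2 ≤ |z.im|
  · have h1 : Real.sinh |z.im| ≤ ‖Complex.sin z‖ := by
      have h2 : ‖Complex.sin z‖ ^ 2 = Real.sin z.re ^ 2 + Real.sinh z.im ^ 2 := by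
        rw [hsin, ← Complex.normSq_eq_norm_sq, Complex.normSq_mk]
        have h3 := Real.cosh_sq z.im
        have h4 := Real.sin_sq_add_cos_sq z.re
        linear_combination Real.sin z.re ^ 2 * h3 + Real.sinh z.im ^ 2 * h4
      have h5 : Real.sinh |z.im| ^ 2 = Real.sinh z.im ^ 2 := by
        rcases abs_choice z.im with h | h <;> rw [h]
        rw [Real.sinh_neg, neg_sq]
      refine le_of_sq_le_sq ?_ (norm_nonneg _)
      nlinarith [sq_nonneg (Real.sin z.re)]
    have h2 : Real.exp (-|z.im|) ≤ Real.exp |z.im| * Real.exp (-r) := by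
      rw [← Real.exp_add]
      exact Real.exp_le_exp.2 (by linarith)
    have h3 : (1 - Real.exp (-r)) / 2 * Real.exp |z.im| ≤ Real.sinh |z.im| := by
      rw [Real.sinh_eq]; linarith
    exact (mul_le_mul_of_nonneg_right (min_le_right _ _) hE.le).trans (h3.trans h1)
  · push Not at hy
    set k := round (z.re / Real.pi)
    have h1 : |z.re - k * Real.pi| ≤ Real.pi / 2 := by
      have := abs_sub_round (z.re / Real.pi)
      have h2 : z.re - k * Real.pi = (z.re / Real.pi - k) * Real.pi := by field_simp
      rw [h2, abs_mul, abs_of_pos hpi]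
      nlinarith
    have h2 : r / 2 ≤ |z.re - k * Real.pi| := by
      have h3 := (hz k).trans (Complex.norm_le_abs_re_add_abs_im _)
      have h4 : (z - k * Real.pi).re = z.re - k * Real.pi := by simp
      have h5 : (z - k * Real.pi).im = z.im := by simp
      rw [h4, h5] at h3
      linarith
    have h3 := Real.mul_abs_le_abs_sin h1
    rw [Real.sin_sub_int_mul_pi, abs_mul, abs_zpow, abs_neg, abs_one, one_zpow, one_mul] at h3
    have h4 : r / Real.pi ≤ |Real.sin z.re| := by
      refine le_trans ?_ h3
      rw [div_mul_eq_mul_div]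
      gcongr
      linarith
    calc _ ≤ r / (2 * Real.pi) * Real.exp |z.im| :=
          mul_le_mul_of_nonneg_right (min_le_left _ _) hE.le
      _ = r / Real.pi * (Real.exp |z.im| / 2) := by ring
      _ ≤ |Real.sin z.re| * Real.cosh z.im := by gcongr
      _ ≤ _ := hre

/-- Division of entire functions with simple zeros. -/
theorem exists_eq_mul_of_simple_zeros {f g : ℂ → ℂ} (hf : Differentiable ℂ f)
    (hg : Differentiable ℂ g) (h : ∀ z, g z = 0 → f z = 0 ∧ deriv g z ≠ 0) :
    ∃ q : ℂ → ℂ, Differentiable ℂ q ∧ ∀ z, f z = q z * g z := by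
  classical
  let q : ℂ → ℂ := fun z => if g z = 0 then deriv f z / deriv g z else f z / g z
  refine ⟨q, fun z₀ => ?_, fun z => ?_⟩
  · by_cases h0 : g z₀ = 0
    · obtain ⟨hf0, hg0⟩ := h z₀ h0
      have hne : dslope g z₀ z₀ ≠ 0 := by rwa [dslope_same]
      -- Near a zero of `g`, the function `q` is a quotient of two difference quotients, and the
      -- lower one is nonzero at `z₀` because the zero is simple.
      refine (((hf.dslope z₀) z₀).div ((hg.dslope z₀) z₀) hne).congr_of_eventuallyEq ?_
      filter_upwards [(hg.dslope z₀).continuous.continuousAt.eventually_ne hne] with z hz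
      by_cases hzz : z = z₀
      · subst hzz
        simp [q, h0]
      · have hsub : z - z₀ ≠ 0 := sub_ne_zero.2 hzz
        rw [dslope_of_ne _ hzz, slope_def_field, h0, sub_zero] at hz
        have hgz : g z ≠ 0 := fun hgz => hz (by rw [hgz, zero_div])
        simp only [q, hgz, if_false, Pi.div_apply]
        rw [dslope_of_ne _ hzz, dslope_of_ne _ hzz, slope_def_field, slope_def_field, h0, hf0,
          sub_zero, sub_zero]
        field_simp
    · refine ((hf z₀).div (hg z₀) h0).congr_of_eventuallyEq ?_
      filter_upwards [hg.continuous.continuousAt.eventually_ne h0] with z hz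
      simp [q, hz]
  · by_cases h0 : g z = 0
    · rw [(h z h0).1, h0, mul_zero]
    · simp [q, h0]

/-- An entire function that vanishes at the zeros of the cosine and is small compared with
`exp |im z|` is zero. -/
theorem eq_zero_of_vanishing_at_cos_zeros {f : ℂ → ℂ} (hf : Differentiable ℂ f) {C : ℝ}
    (h0 : ∀ z, Complex.cos z = 0 → f z = 0)
    (hC : ∀ z, ‖f z‖ ≤ C * Real.exp |z.im| / (1 + ‖z‖)) (z : ℂ) : f z = 0 := by
  have hpi := Real.pi_gt_three
  have hC0 : 0 ≤ C := by
    have := (norm_nonneg _).trans (hC 0)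
    simpa using this
  obtain ⟨q, hq, hfq⟩ := exists_eq_mul_of_simple_zeros hf Complex.differentiable_cos fun z hz => ⟨h0 z hz, by
    rw [Complex.deriv_cos, neg_ne_zero]
    intro hs
    have := Complex.sin_sq_add_cos_sq z
    rw [hs, hz] at this
    norm_num at this⟩
  obtain ⟨c, hc, hsin⟩ := Complex.exists_le_norm_sin one_pos
  have hoff : ∀ w : ℂ, (∀ k : ℤ, 1 ≤ ‖w + Real.pi / 2 - k * Real.pi‖) →
      ‖q w‖ ≤ C / c / (1 + ‖w‖) := fun w hw => by
    have h1 := hsin _ hw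
    have him : (w + Real.pi / 2).im = w.im := by
      rw [show (Real.pi : ℂ) / 2 = ((Real.pi / 2 : ℝ) : ℂ) by push_cast; ring, Complex.add_im,
        Complex.ofReal_im, add_zero]
    rw [Complex.sin_add_pi_div_two, him] at h1
    have h2 := hC w
    rw [hfq, norm_mul] at h2
    have hE := Real.exp_pos |w.im|
    have h3 : ‖q w‖ * (c * Real.exp |w.im|) ≤ C * Real.exp |w.im| / (1 + ‖w‖) :=
      (mul_le_mul_of_nonneg_left h1 (norm_nonneg _)).trans h2
    have h4 : ‖q w‖ * (c * Real.exp |w.im|) ≤ C / c / (1 + ‖w‖) * (c * Real.exp |w.im|) := by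
      refine h3.trans_eq ?_
      field_simp
    exact le_of_mul_le_mul_right h4 (by positivity)
  -- Inside a unit disc around a zero of the cosine, the maximum principle carries the bound over
  -- from the circle, which stays at distance at least 1 from the other zeros since `π > 2`. The 3
  -- comes from `1 + ‖w‖ ≤ 3 + ‖v‖ ≤ 3 (1 + ‖v‖)`.
  have hall : ∀ w : ℂ, ‖q w‖ ≤ 3 * (C / c) / (1 + ‖w‖) := fun w => by
    by_cases hw : ∀ k : ℤ, 1 ≤ ‖w + Real.pi / 2 - k * Real.pi‖
    · refine (hoff w hw).trans ?_
      gcongr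
      have : 0 ≤ C / c := by positivity
      linarith
    · push Not at hw
      obtain ⟨k, hk⟩ := hw
      set b : ℂ := k * Real.pi - Real.pi / 2 with hb
      have hwb : w ∈ Metric.ball b 1 := by
        rw [Metric.mem_ball, dist_eq_norm, hb]
        rwa [show w - (k * Real.pi - Real.pi / 2) = w + Real.pi / 2 - k * Real.pi by ring]
      refine Complex.norm_le_of_forall_mem_frontier_norm_le (U := Metric.ball b 1)
        Metric.isBounded_ball hq.diffContOnCl (fun v hv => ?_) (subset_closure hwb)
      rw [frontier_ball _ one_ne_zero, Metric.mem_sphere, dist_eq_norm] at hv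
      refine (hoff v fun j => ?_).trans ?_
      · by_cases hjk : j = k
        · rw [hjk, show v + Real.pi / 2 - k * Real.pi = v - b by rw [hb]; ring, hv]
        · have h1 : v + Real.pi / 2 - j * Real.pi = (v - b) - ((j - k : ℤ) : ℂ) * Real.pi := by
            rw [hb]; push_cast; ring
          have h2 : Real.pi ≤ ‖((j - k : ℤ) : ℂ) * Real.pi‖ := by
            rw [norm_mul, Complex.norm_real, Real.norm_of_nonneg Real.pi_pos.le,
              Complex.norm_intCast]
            have h3 : (1 : ℝ) ≤ |((j - k : ℤ) : ℝ)| := by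
              exact_mod_cast Int.one_le_abs (sub_ne_zero.2 hjk)
            nlinarith
          have h4 := norm_sub_norm_le (((j - k : ℤ) : ℂ) * Real.pi) (v - b)
          rw [norm_sub_rev _ (v - b), ← h1] at h4
          linarith
      · have h1 : ‖w‖ ≤ ‖v‖ + 2 := by
          have h2 : ‖w - b‖ < 1 := by rwa [← dist_eq_norm]
          have h3 : w = v + ((w - b) - (v - b)) := by ring
          have h4 := norm_add_le v ((w - b) - (v - b))
          rw [← h3] at h4
          have h5 := norm_sub_le (w - b) (v - b)
          linarith
        rw [div_le_div_iff₀ (by positivity) (by positivity)]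
        have : 0 ≤ C / c := by positivity
        nlinarith [norm_nonneg v]
  -- Liouville's theorem now gives `q = 0`. The decay is essential: without it, `f` could be a
  -- multiple of the cosine.
  have hlim : Tendsto q (cocompact ℂ) (𝓝 0) := by
    refine squeeze_zero_norm hall ?_
    have h1 : Tendsto (fun w : ℂ => 1 + ‖w‖) (cocompact ℂ) atTop :=
      tendsto_atTop_add_const_left _ _ tendsto_norm_cocompact_atTop
    exact h1.const_div_atTop _
  rw [hfq, hq.apply_eq_of_tendsto_cocompact z hlim, zero_mul]

/-! ### The interpolation basis at the zeros of the cosine. -/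

/-- The positive zeros of the cosine. -/
noncomputable def cosNode (n : ℕ) : ℝ := n * Real.pi + Real.pi / 2

/-- The entire function `cos z / (z ^ 2 - a ^ 2)`, where `a` is the `n`-th positive zero of the
cosine. -/
noncomputable def cosQuot (n : ℕ) : ℂ → ℂ :=
  dslope (dslope Complex.cos (cosNode n)) (-(cosNode n))

theorem one_lt_cosNode (n : ℕ) : 1 < cosNode n := by
  have := Real.pi_gt_three
  have h : 0 ≤ (n : ℝ) * Real.pi := by positivity
  unfold cosNode; linarith

theorem add_one_le_cosNode (n : ℕ) : (n : ℝ) + 1 ≤ cosNode n := by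
  have := Real.pi_gt_three
  have h : (n : ℝ) * 1 ≤ n * Real.pi := by gcongr; linarith
  unfold cosNode; linarith

theorem cos_cosNode (n : ℕ) : Complex.cos (cosNode n) = 0 := by
  rw [← Complex.ofReal_cos, cosNode, Real.cos_add_pi_div_two, Real.sin_nat_mul_pi]
  simp

theorem sin_cosNode (n : ℕ) : Complex.sin (cosNode n) = (-1) ^ n := by
  rw [← Complex.ofReal_sin, cosNode, Real.sin_add_pi_div_two, Real.cos_nat_mul_pi]
  simp

theorem cosNode_injective : Function.Injective cosNode := fun m n h => by
  have h1 : (m : ℝ) * Real.pi = n * Real.pi := by simpa [cosNode] using h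
  exact_mod_cast mul_right_cancel₀ Real.pi_pos.ne' h1

theorem cos_eq_zero_iff_cosNode {z : ℂ} :
    Complex.cos z = 0 ↔ ∃ n : ℕ, z = cosNode n ∨ z = -(cosNode n : ℂ) := by
  constructor
  · intro h
    obtain ⟨k, rfl⟩ := Complex.cos_eq_zero_iff.1 h
    rcases Int.eq_nat_or_neg k with ⟨n, rfl | rfl⟩
    · exact ⟨n, Or.inl (by unfold cosNode; push_cast; ring)⟩
    · rcases n with _ | n
      · exact ⟨0, Or.inl (by unfold cosNode; push_cast; ring)⟩
      · exact ⟨n, Or.inr (by unfold cosNode; push_cast; ring)⟩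
  · rintro ⟨n, rfl | rfl⟩
    · exact cos_cosNode n
    · rw [Complex.cos_neg, cos_cosNode]

theorem differentiable_cosQuot (n : ℕ) : Differentiable ℂ (cosQuot n) :=
  (Complex.differentiable_cos.dslope _).dslope _

theorem sub_mul_dslope_cos (n : ℕ) (z : ℂ) :
    (z - cosNode n) * dslope Complex.cos (cosNode n) z = Complex.cos z := by
  have := sub_smul_dslope Complex.cos (cosNode n : ℂ) z
  rwa [cos_cosNode, sub_zero, smul_eq_mul] at this

theorem add_mul_cosQuot (n : ℕ) (z : ℂ) :
    (z + cosNode n) * cosQuot n z = dslope Complex.cos (cosNode n) z := by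
  have h0 : dslope Complex.cos (cosNode n) (-(cosNode n : ℂ)) = 0 := by
    have h1 := sub_mul_dslope_cos n (-(cosNode n : ℂ))
    rw [Complex.cos_neg, cos_cosNode, mul_eq_zero] at h1
    refine h1.resolve_left fun h => ?_
    have h2 : ((-cosNode n - cosNode n : ℝ) : ℂ) = 0 := by push_cast; exact h
    have := one_lt_cosNode n
    have h3 := Complex.ofReal_eq_zero.1 h2
    linarith
  have := sub_smul_dslope (dslope Complex.cos (cosNode n)) (-(cosNode n : ℂ)) z
  rwa [h0, sub_zero, smul_eq_mul, sub_neg_eq_add] at this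

theorem mul_cosQuot (n : ℕ) (z : ℂ) :
    (z ^ 2 - (cosNode n : ℂ) ^ 2) * cosQuot n z = Complex.cos z := by
  rw [← sub_mul_dslope_cos n z, ← add_mul_cosQuot]; ring

theorem cosQuot_neg (n : ℕ) (z : ℂ) : cosQuot n (-z) = cosQuot n z := by
  have hd : Dense ({(cosNode n : ℂ), -(cosNode n : ℂ)} : Set ℂ)ᶜ :=
    (Set.toFinite _).countable.dense_compl ℂ
  refine congrFun (Continuous.ext_on hd
    ((differentiable_cosQuot n).continuous.comp continuous_neg)
    (differentiable_cosQuot n).continuous fun w hw => ?_) z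
  have h1 : w ^ 2 - (cosNode n : ℂ) ^ 2 ≠ 0 := fun h => hw (by
    rcases sq_eq_sq_iff_eq_or_eq_neg.1 (sub_eq_zero.1 h) with h | h <;> simp [h])
  refine mul_left_cancel₀ h1 ?_
  rw [mul_cosQuot, ← neg_sq w, Function.comp_apply, mul_cosQuot, Complex.cos_neg]

/-- The derivative of the cosine at the node is `-(-1)^n`. This normalises the basis: with
coefficient `-(2 a (-1)^n d(a))` the series reproduces `d` at the node `a`. -/
theorem cosQuot_cosNode_self (n : ℕ) :
    2 * cosNode n * cosQuot n (cosNode n) = -(-1) ^ n := by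
  have h := add_mul_cosQuot n (cosNode n)
  rw [dslope_same, Complex.deriv_cos, sin_cosNode] at h
  rw [← h]; ring

theorem cosQuot_cosNode_of_ne {m n : ℕ} (h : m ≠ n) : cosQuot n (cosNode m) = 0 := by
  have h1 := mul_cosQuot n (cosNode m)
  rw [cos_cosNode, mul_eq_zero] at h1
  refine h1.resolve_left fun h2 => h (cosNode_injective ?_)
  have h3 : cosNode m ^ 2 = cosNode n ^ 2 := by exact_mod_cast sub_eq_zero.1 h2
  have := one_lt_cosNode m
  have := one_lt_cosNode n
  exact (pow_left_inj₀ (by linarith) (by linarith) two_ne_zero).1 h3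

/-- Sum of two bounds: the growth of `cos z` itself, and the mean value inequality on the convex
strip `|im w| ≤ |im z|`, which contains both `z` and the node. -/
theorem norm_dslope_cos_le (n : ℕ) (z : ℂ) :
    (1 + ‖z - cosNode n‖) * ‖dslope Complex.cos (cosNode n) z‖ ≤ 2 * Real.exp |z.im| := by
  have h1 : ‖z - cosNode n‖ * ‖dslope Complex.cos (cosNode n) z‖ ≤ Real.exp |z.im| := by
    rw [← norm_mul, sub_mul_dslope_cos]
    exact Complex.norm_cos_le_exp z
  have h2 : ‖dslope Complex.cos (cosNode n) z‖ ≤ Real.exp |z.im| := by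
    by_cases hz : z = cosNode n
    · rw [hz, dslope_same, Complex.deriv_cos, norm_neg]
      exact Complex.norm_sin_le_exp _
    · have hz' : 0 < ‖z - cosNode n‖ := norm_pos_iff.2 (sub_ne_zero.2 hz)
      have hconv : Convex ℝ {w : ℂ | |w.im| ≤ |z.im|} := by
        have : {w : ℂ | |w.im| ≤ |z.im|} = Complex.imLm ⁻¹' (Icc (-|z.im|) |z.im|) := by
          ext w; simp [abs_le]
        rw [this]
        exact (convex_Icc _ _).linear_preimage _
      have := hconv.norm_image_sub_le_of_norm_hasDerivWithin_le (f := Complex.cos)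
        (f' := fun w => -Complex.sin w) (C := Real.exp |z.im|) (x := cosNode n) (y := z)
        (fun w _ => (Complex.hasDerivAt_cos w).hasDerivWithinAt)
        (fun w hw => by
          rw [norm_neg]
          exact (Complex.norm_sin_le_exp w).trans (Real.exp_le_exp.2 hw))
        (by simp) (by simp)
      rw [cos_cosNode, sub_zero, ← sub_mul_dslope_cos n z, norm_mul, mul_comm] at this
      exact le_of_mul_le_mul_right this hz'
  linarith

/-- In the right half-plane `‖z + a‖ ≥ 1`, so replacing `‖z + a‖` by `1 + ‖z + a‖` costs a factor 2.
Evenness later makes this half-plane sufficient. -/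
theorem norm_cosQuot_le (n : ℕ) {z : ℂ} (hz : 0 ≤ z.re) :
    ‖cosQuot n z‖ ≤ 4 * Real.exp |z.im| / ((1 + ‖z - cosNode n‖) * (1 + ‖z + cosNode n‖)) := by
  have h1 := norm_dslope_cos_le n z
  rw [← add_mul_cosQuot, norm_mul] at h1
  have h2 : 1 ≤ ‖z + cosNode n‖ := by
    refine le_trans ?_ (Complex.re_le_norm _)
    have := one_lt_cosNode n
    simp; linarith
  rw [le_div_iff₀ (by positivity)]
  have h3 : 0 ≤ ‖cosQuot n z‖ * (1 + ‖z - cosNode n‖) := by positivity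
  nlinarith

theorem norm_le_norm_add_cosNode (n : ℕ) {z : ℂ} (hz : 0 ≤ z.re) : ‖z‖ ≤ ‖z + cosNode n‖ := by
  have := one_lt_cosNode n
  refine le_of_sq_le_sq ?_ (norm_nonneg _)
  rw [← Complex.normSq_eq_norm_sq, ← Complex.normSq_eq_norm_sq, Complex.normSq_apply,
    Complex.normSq_apply]
  simp
  nlinarith

theorem cosNode_le_norm_add_cosNode (n : ℕ) {z : ℂ} (hz : 0 ≤ z.re) :
    cosNode n ≤ ‖z + cosNode n‖ := by
  refine le_trans ?_ (Complex.re_le_norm _)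
  simpa using hz

/-- With `k = ⌊re z / π⌋`, a node with `n ≠ k` has real distance at least `|n - k| π - π/2` from
`z`, which exceeds `|n - k|`. -/
theorem exists_int_le_norm_sub_cosNode (z : ℂ) :
    ∃ k : ℤ, ∀ n : ℕ, 1 + |((n - k : ℤ) : ℝ)| ≤ 1 + ‖z - cosNode n‖ := by
  have hpi := Real.pi_gt_three
  refine ⟨⌊z.re / Real.pi⌋, fun n => ?_⟩
  set k := ⌊z.re / Real.pi⌋
  have h1 : (k : ℝ) * Real.pi ≤ z.re := (le_div_iff₀ Real.pi_pos).1 (Int.floor_le _)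
  have h2 : z.re < (k + 1) * Real.pi := (div_lt_iff₀ Real.pi_pos).1 (Int.lt_floor_add_one _)
  have h3 : |z.re - cosNode n| ≤ ‖z - cosNode n‖ := by
    simpa using Complex.abs_re_le_norm (z - cosNode n)
  have h4 : |((n - k : ℤ) : ℝ)| ≤ |z.re - cosNode n| := by
    unfold cosNode
    rcases lt_trichotomy (n : ℤ) k with h | h | h
    · have h5 : ((n : ℝ)) + 1 ≤ k := by exact_mod_cast h
      rw [abs_of_nonpos (by push_cast; linarith)]
      refine le_trans ?_ (le_abs_self _)
      push_cast
      nlinarith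
    · rw [h]; simp
    · have h5 : (k : ℝ) + 1 ≤ n := by exact_mod_cast h
      rw [abs_of_nonneg (by push_cast; linarith)]
      refine le_trans ?_ (neg_le_abs _)
      push_cast
      nlinarith
  linarith

/-! ### Uniform bounds for the cardinal series. -/

/-- The weights that dominate the cardinal series. -/
noncomputable def cardinalWeight (k : ℤ) (n : ℕ) : ℝ :=
  1 / ((n + 1) * (1 + |((n - k : ℤ) : ℝ)|))

theorem summable_int_inv_sq : Summable fun m : ℤ => 1 / (1 + |(m : ℝ)|) ^ 2 := by
  have h : Summable fun n : ℕ => 1 / (1 + |((n : ℤ) : ℝ)|) ^ 2 := by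
    have := (summable_nat_add_iff 1).2 (Real.summable_one_div_nat_pow.2 one_lt_two)
    refine this.congr fun n => ?_
    push_cast
    rw [Nat.abs_cast, add_comm]
  refine Summable.of_nat_of_neg h ?_
  simpa using h

theorem cardinalWeight_nonneg (k : ℤ) (n : ℕ) : 0 ≤ cardinalWeight k n := by
  unfold cardinalWeight; positivity

/-- Cauchy–Schwarz in its parametric form, `1/(ab) ≤ t/(2a²) + 1/(2tb²)`. The second sum is bounded
by one over all integers, so nothing depends on `k`; the free `t` lets the first sum control the
tail. -/
theorem exists_tsum_cardinalWeight_le : ∃ K : ℝ, 0 < K ∧ ∀ (t : ℝ), 0 < t → ∀ (k : ℤ) (N : ℕ),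
    Summable (fun n => cardinalWeight k (n + N)) ∧
    ∑' n, cardinalWeight k (n + N) ≤
      t / 2 * ∑' n : ℕ, 1 / (((n + N : ℕ) : ℝ) + 1) ^ 2 + K / (2 * t) := by
  have hZ := summable_int_inv_sq
  refine ⟨∑' m : ℤ, 1 / (1 + |(m : ℝ)|) ^ 2, ?_, fun t ht k N => ?_⟩
  · exact hZ.tsum_pos (fun m => by positivity) 0 (by simp)
  have hinj : Function.Injective fun n : ℕ => ((n + N : ℕ) : ℤ) - k := fun a b h => by
    simpa using h
  have hu : Summable fun n : ℕ => 1 / (((n + N : ℕ) : ℝ) + 1) ^ 2 := by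
    have := (summable_nat_add_iff (N + 1)).2 (Real.summable_one_div_nat_pow.2 one_lt_two)
    refine this.congr fun n => ?_
    push_cast; ring
  have hv : Summable fun n : ℕ => 1 / (1 + |((((n + N : ℕ) : ℤ) - k : ℤ) : ℝ)|) ^ 2 :=
    hZ.comp_injective hinj
  have hle : ∀ n : ℕ, cardinalWeight k (n + N) ≤ t / 2 * (1 / (((n + N : ℕ) : ℝ) + 1) ^ 2) +
      1 / (2 * t) * (1 / (1 + |((((n + N : ℕ) : ℤ) - k : ℤ) : ℝ)|) ^ 2) := fun n => by
    unfold cardinalWeight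
    have h1 : 0 < ((n + N : ℕ) : ℝ) + 1 := by positivity
    have h2 : 0 < 1 + |((((n + N : ℕ) : ℤ) - k : ℤ) : ℝ)| := by positivity
    generalize ((n + N : ℕ) : ℝ) + 1 = a at h1 ⊢
    generalize 1 + |((((n + N : ℕ) : ℤ) - k : ℤ) : ℝ)| = b at h2 ⊢
    have h3 : t / 2 * (1 / a ^ 2) + 1 / (2 * t) * (1 / b ^ 2) - 1 / (a * b) =
        (t * b - a) ^ 2 / (2 * t * a ^ 2 * b ^ 2) := by
      field_simp; ring
    have h4 : 0 ≤ (t * b - a) ^ 2 / (2 * t * a ^ 2 * b ^ 2) := by positivity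
    linarith
  have hs := (hu.mul_left (t / 2)).add (hv.mul_left (1 / (2 * t)))
  have hsum : Summable (fun n => cardinalWeight k (n + N)) :=
    Summable.of_nonneg_of_le (fun n => cardinalWeight_nonneg k _) hle hs
  refine ⟨hsum, (hsum.tsum_le_tsum hle hs).trans ?_⟩
  rw [(hu.mul_left (t / 2)).tsum_add (hv.mul_left (1 / (2 * t))), tsum_mul_left, tsum_mul_left]
  have h5 := tsum_comp_le_tsum_of_inj hZ (fun m => by positivity) hinj
  have h6 : (∑' m : ℤ, 1 / (1 + |(m : ℝ)|) ^ 2) / (2 * t) =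
    1 / (2 * t) * ∑' m : ℤ, 1 / (1 + |(m : ℝ)|) ^ 2 := by ring
  rw [h6]
  gcongr
  exact h5

theorem summable_cardinalWeight (k : ℤ) (N : ℕ) : Summable fun n => cardinalWeight k (n + N) := by
  obtain ⟨K, -, h⟩ := exists_tsum_cardinalWeight_le
  exact (h 1 one_pos k N).1

theorem exists_tsum_cardinalWeight_bound : ∃ B : ℝ, ∀ k, ∑' n, cardinalWeight k n ≤ B := by
  obtain ⟨K, -, h⟩ := exists_tsum_cardinalWeight_le
  exact ⟨_, fun k => (h 1 one_pos k 0).2⟩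

theorem exists_tsum_cardinalWeight_tail {δ : ℝ} (hδ : 0 < δ) :
    ∃ N₀ : ℕ, ∀ N, N₀ ≤ N → ∀ k, ∑' n, cardinalWeight k (n + N) ≤ δ := by
  obtain ⟨K, hK, h⟩ := exists_tsum_cardinalWeight_le
  have hlim := tendsto_sum_nat_add fun n : ℕ => 1 / ((n : ℝ) + 1) ^ 2
  obtain ⟨N₀, hN₀⟩ := eventually_atTop.1 (hlim.eventually_le_const (u := δ ^ 2 / K) (by positivity))
  -- With `t = K/δ` each of the two terms is at most `δ/2`, the first because the tail is at most
  -- `δ²/K`.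
  refine ⟨N₀, fun N hN k => (h (K / δ) (by positivity) k N).2.trans ?_⟩
  have h1 := hN₀ N hN
  have h2 : K / δ / 2 * ∑' n : ℕ, 1 / (((n + N : ℕ) : ℝ) + 1) ^ 2 ≤ K / δ / 2 * (δ ^ 2 / K) := by
    gcongr
  have h3 : K / δ / 2 * (δ ^ 2 / K) + K / (2 * (K / δ)) = δ := by field_simp; ring
  linarith

/-- Cardinal series expansion over the zeros of the cosine, with a uniform remainder estimate. -/
theorem exists_norm_sub_cardinalSum_le {d : ℂ → ℂ} (hd : Differentiable ℂ d)
    (heven : ∀ z, d (-z) = d z) {C : ℝ}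
    (hC : ∀ z, ‖d z‖ ≤ C * Real.exp |z.im| / (1 + ‖z‖) ^ 2) {δ : ℝ} (hδ : 0 < δ) :
    ∃ N₀ : ℕ, ∀ N, N₀ ≤ N → ∀ z,
      ‖d z - ∑ n ∈ Finset.range N,
        -(2 * cosNode n * (-1) ^ n * d (cosNode n)) * cosQuot n z‖ ≤
        δ * Real.exp |z.im| / (1 + ‖z‖) := by
  have hC0 : 0 ≤ C := by
    have := (norm_nonneg _).trans (hC 0)
    simpa using this
  set F : ℕ → ℂ → ℂ := fun n z => -(2 * cosNode n * (-1) ^ n * d (cosNode n)) * cosQuot n z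
    with hF
  have hFneg : ∀ n z, F n (-z) = F n z := fun n z => by simp only [hF, cosQuot_neg]
  have hcoef : ∀ n : ℕ, ‖-(2 * cosNode n * (-1) ^ n * d (cosNode n))‖ ≤ 2 * C / (n + 1) :=
    fun n => by
    have ha := one_lt_cosNode n
    have ha' := add_one_le_cosNode n
    have h1 := hC (cosNode n)
    have hnorm : ‖(cosNode n : ℂ)‖ = cosNode n := by
      rw [Complex.norm_real, Real.norm_of_nonneg (by linarith)]
    rw [hnorm, Complex.ofReal_im, abs_zero, Real.exp_zero, mul_one] at h1
    rw [norm_neg, norm_mul, norm_mul, norm_mul, hnorm, norm_pow, norm_neg, norm_one, one_pow,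
      Complex.norm_ofNat, mul_one]
    calc _ ≤ 2 * cosNode n * (C / (1 + cosNode n) ^ 2) := by gcongr
      _ ≤ 2 * C / cosNode n := by
        rw [← mul_div_assoc, div_le_div_iff₀ (by positivity) (by linarith)]
        have h2 : cosNode n * cosNode n ≤ (1 + cosNode n) ^ 2 := by nlinarith
        nlinarith [mul_le_mul_of_nonneg_left h2 hC0]
      _ ≤ _ := by gcongr
  have hFle : ∀ {z : ℂ}, 0 ≤ z.re → ∀ n : ℕ, ‖F n z‖ ≤ 2 * C / (n + 1) *
      (4 * Real.exp |z.im| / ((1 + ‖z - cosNode n‖) * (1 + ‖z + cosNode n‖))) :=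
    fun {z} hz n => by
    rw [hF, norm_mul]
    exact mul_le_mul (hcoef n) (norm_cosQuot_le n hz) (norm_nonneg _) (by positivity)
  have hright : ∀ {p : ℂ → Prop}, (∀ z, p (-z) → p z) → (∀ z, 0 ≤ z.re → p z) → ∀ z, p z :=
    fun {p} h1 h2 z => by
    rcases le_total 0 z.re with h | h
    · exact h2 z h
    · exact h1 z (h2 _ (by simpa using h))
  -- Here `‖z + a‖ ≥ ‖z‖` is spent on the weight in `z`; the decay in `n` comes from the coefficient
  -- and from `‖z - a‖`.
  have hweight : ∀ z : ℂ, ∃ k : ℤ, ∀ n : ℕ,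
      ‖F n z‖ ≤ 8 * C * Real.exp |z.im| / (1 + ‖z‖) * cardinalWeight k n := by
    refine hright (fun z h => by simpa [hFneg] using h) fun z hz => ?_
    obtain ⟨k, hk⟩ := exists_int_le_norm_sub_cosNode z
    refine ⟨k, fun n => (hFle hz n).trans ?_⟩
    have h1 := hk n
    have h2 := norm_le_norm_add_cosNode n hz
    calc _ ≤ 2 * C / (n + 1) *
          (4 * Real.exp |z.im| / ((1 + |((n - k : ℤ) : ℝ)|) * (1 + ‖z‖))) := by gcongr
      _ = _ := by unfold cardinalWeight; field_simp; ring
  -- Here `‖z + a‖ ≥ a ≥ n + 1` is used instead, giving a locally uniform summable majorant and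
  -- hence an entire sum.
  have hlocal : ∀ (R : ℝ) (n : ℕ) (z : ℂ), ‖z‖ < R →
      ‖F n z‖ ≤ 8 * C * Real.exp R * (1 / ((n : ℝ) + 1) ^ 2) := fun R n => by
    refine hright (fun z h => by simpa [hFneg] using h) fun z hz hzR => (hFle hz n).trans ?_
    have h1 := cosNode_le_norm_add_cosNode n hz
    have h2 := add_one_le_cosNode n
    have h3 : |z.im| ≤ R := (Complex.abs_im_le_norm z).trans hzR.le
    calc _ ≤ 2 * C / (n + 1) * (4 * Real.exp R / (1 * ((n : ℝ) + 1))) := by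
          refine mul_le_mul_of_nonneg_left (div_le_div₀ (by positivity) (by gcongr)
            (by positivity) (mul_le_mul ?_ (by linarith) (by positivity) (by positivity)))
            (by positivity)
          linarith [norm_nonneg (z - cosNode n)]
      _ = _ := by field_simp; ring
  have hu : Summable fun n : ℕ => 1 / ((n : ℝ) + 1) ^ 2 := by
    have := (summable_nat_add_iff 1).2 (Real.summable_one_div_nat_pow.2 one_lt_two)
    exact this.congr fun n => by push_cast; rfl
  have hsummable : ∀ z, Summable fun n => F n z := fun z =>
    Summable.of_norm_bounded (hu.mul_left (8 * C * Real.exp (‖z‖ + 1)))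
      fun n => hlocal _ n z (by linarith)
  have hdiff : Differentiable ℂ fun z => ∑' n, F n z := fun z => by
    refine (Complex.differentiableOn_tsum_of_summable_norm (U := Metric.ball 0 (‖z‖ + 1))
      (hu.mul_left (8 * C * Real.exp (‖z‖ + 1)))
      (fun n => ((differentiable_cosQuot n).const_mul _).differentiableOn) Metric.isOpen_ball
      fun n w hw => hlocal _ n w (by simpa using hw)).differentiableAt
      (Metric.isOpen_ball.mem_nhds (by simp))
  have hexpand : ∀ z, d z = ∑' n, F n z := by
    obtain ⟨B, hB⟩ := exists_tsum_cardinalWeight_bound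
    intro z
    refine sub_eq_zero.1 (eq_zero_of_vanishing_at_cos_zeros (f := fun z => d z - ∑' n, F n z)
      (C := C + 8 * C * B) (hd.sub hdiff) ?_ ?_ z)
    · have hnode : ∀ m, d (cosNode m) - ∑' n, F n (cosNode m) = 0 := fun m => by
        rw [tsum_eq_single m fun n hn => by
          simp only [hF]; rw [cosQuot_cosNode_of_ne hn.symm, mul_zero], sub_eq_zero]
        have h1 := cosQuot_cosNode_self m
        have h2 : ((-1 : ℂ) ^ m) * (-1) ^ m = 1 := by rw [← mul_pow]; simp
        simp only [hF]
        linear_combination (-1) ^ m * d (cosNode m) * h1 - d (cosNode m) * h2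
      intro w hw
      obtain ⟨m, rfl | rfl⟩ := cos_eq_zero_iff_cosNode.1 hw
      · exact hnode m
      · simp only [heven, hFneg]
        exact hnode m
    · intro w
      obtain ⟨k, hk⟩ := hweight w
      have h1 := tsum_of_norm_bounded
        ((summable_cardinalWeight k 0).mul_left (8 * C * Real.exp |w.im| / (1 + ‖w‖))).hasSum hk
      rw [tsum_mul_left] at h1
      have h2 : C * Real.exp |w.im| / (1 + ‖w‖) ^ 2 ≤ C * Real.exp |w.im| / (1 + ‖w‖) := by
        have h3 : 1 + ‖w‖ ≤ (1 + ‖w‖) ^ 2 := by nlinarith [norm_nonneg w]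
        gcongr
      have h4 : 8 * C * Real.exp |w.im| / (1 + ‖w‖) * ∑' n, cardinalWeight k (n + 0) ≤
          8 * C * Real.exp |w.im| / (1 + ‖w‖) * B := by
        gcongr
        exact hB k
      calc _ ≤ ‖d w‖ + ‖∑' n, F n w‖ := norm_sub_le _ _
        _ ≤ C * Real.exp |w.im| / (1 + ‖w‖) + 8 * C * Real.exp |w.im| / (1 + ‖w‖) * B :=
          add_le_add ((hC w).trans h2) (h1.trans h4)
        _ = _ := by ring
  -- The added 1 covers `C = 0`.
  obtain ⟨N₀, hN₀⟩ := exists_tsum_cardinalWeight_tail (δ := δ / (8 * C + 1)) (by positivity)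
  refine ⟨N₀, fun N hN z => ?_⟩
  obtain ⟨k, hk⟩ := hweight z
  rw [hexpand z, ← (hsummable z).sum_add_tsum_nat_add N, add_sub_cancel_left]
  have h1 := tsum_of_norm_bounded
    ((summable_cardinalWeight k N).mul_left (8 * C * Real.exp |z.im| / (1 + ‖z‖))).hasSum
    fun n => hk (n + N)
  rw [tsum_mul_left] at h1
  refine h1.trans ?_
  calc _ ≤ 8 * C * Real.exp |z.im| / (1 + ‖z‖) * (δ / (8 * C + 1)) := by
        gcongr
        exact hN₀ N hN k
    _ = (8 * C / (8 * C + 1)) * (δ * Real.exp |z.im| / (1 + ‖z‖)) := by field_simp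
    _ ≤ 1 * (δ * Real.exp |z.im| / (1 + ‖z‖)) := by
        gcongr
        rw [div_le_one (by positivity)]
        linarith
    _ = _ := one_mul _

/-! ### Stability of the zeros under weighted perturbations. -/

/-- Around finitely many points of an open disc there are small disjoint closed discs. -/
theorem Set.Finite.exists_radius {Z : Set ℂ} (hZ : Z.Finite) {R δ : ℝ} (hδ : 0 < δ)
    (hR : ∀ z ∈ Z, ‖z‖ < R) : ∃ s : ℝ, 0 < s ∧ s ≤ δ ∧ (∀ z ∈ Z, ‖z‖ + s < R) ∧
      ∀ z ∈ Z, ∀ w ∈ Z, z ≠ w → s + s < dist z w := by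
  have hlt : ∀ a : ℝ, 0 < a → ∀ᶠ s in 𝓝[>] (0 : ℝ), s < a := fun a ha =>
    (eventually_lt_nhds ha).filter_mono nhdsWithin_le_nhds
  have h1 : ∀ᶠ s in 𝓝[>] (0 : ℝ), ∀ z ∈ Z, ‖z‖ + s < R :=
    (eventually_all_finite hZ).2 fun z hz =>
      (hlt (R - ‖z‖) (sub_pos.2 (hR z hz))).mono fun s hs => by linarith
  have h2 : ∀ᶠ s in 𝓝[>] (0 : ℝ), ∀ z ∈ Z, ∀ w ∈ Z, z ≠ w → s + s < dist z w := by
    refine (eventually_all_finite hZ).2 fun z _ => (eventually_all_finite hZ).2 fun w _ => ?_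
    by_cases hzw : z = w
    · exact Eventually.of_forall fun s h => absurd hzw h
    · exact (hlt (dist z w / 2) (half_pos (dist_pos.2 hzw))).mono fun s hs _ => by linarith
  obtain ⟨s, ⟨⟨h1, h2⟩, h3⟩, h4⟩ :=
    (((h1.and h2).and (hlt δ hδ)).and self_mem_nhdsWithin).exists
  exact ⟨s, h4, h3.le, h1, h2⟩

/-- Zeros of an entire function asymptotic to `sin (ρ L) / ρ` are uniformly stable under
perturbations that are uniformly small compared with `exp (|im ρ| L) / (1 + |ρ|)`. -/
theorem exists_stability_zeros_of_sine_asymptotics {L : ℝ} (hL : 0 < L) {f : ℂ → ℂ}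
    (hf : Differentiable ℂ f) {C : ℝ}
    (hC : ∀ ρ, ‖ρ * f ρ - Complex.sin (ρ * L)‖ ≤ C * Real.exp (|ρ.im| * L) / (1 + ‖ρ‖))
    {ε : ℝ} (hε : 0 < ε) : ∃ η : ℝ, 0 < η ∧ ∀ g : ℂ → ℂ, Differentiable ℂ g →
      (∀ ρ, ‖f ρ - g ρ‖ ≤ η * Real.exp (|ρ.im| * L) / (1 + ‖ρ‖)) →
      ∃ e : ZeroWithMultiplicity f ≃ ZeroWithMultiplicity g,
        ∀ p : ZeroWithMultiplicity f, ‖p.point - (e p).point‖ ≤ ε := by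
  have hpi := Real.pi_pos
  set h : ℝ := Real.pi / L with hh
  have hh0 : 0 < h := by positivity
  -- `ε/2` limits the displacement; `h/4` keeps discs around points of spacing `h` disjoint.
  set r : ℝ := min (ε / 2) (h / 4) with hr
  have hr0 : 0 < r := lt_min (by positivity) (by positivity)
  have hrh : r ≤ h / 4 := min_le_right _ _
  obtain ⟨c, hc, hsin⟩ := Complex.exists_le_norm_sin (mul_pos hr0 hL)
  have hnode : ∀ k : ℤ, ‖((k * h : ℝ) : ℂ)‖ = |(k : ℝ)| * h := fun k => by
    rw [Complex.norm_real, Real.norm_eq_abs, abs_mul, abs_of_pos hh0]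
  have hoff : ∀ ρ : ℂ, 2 * |C| / c ≤ ‖ρ‖ → (∀ k : ℤ, r ≤ ‖ρ - ((k * h : ℝ) : ℂ)‖) →
      c / 2 * Real.exp (|ρ.im| * L) / (1 + ‖ρ‖) ≤ ‖f ρ‖ := fun ρ hρ hk => by
    have h1 := hsin (ρ * L) fun k => by
      have h2 : ρ * L - k * Real.pi = (ρ - ((k * h : ℝ) : ℂ)) * L := by
        have : (L : ℂ) ≠ 0 := Complex.ofReal_ne_zero.2 hL.ne'
        rw [hh]; push_cast; field_simp
      rw [h2, norm_mul, Complex.norm_real, Real.norm_of_nonneg hL.le]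
      exact mul_le_mul_of_nonneg_right (hk k) hL.le
    have him : |(ρ * L).im| = |ρ.im| * L := by
      rw [Complex.im_mul_ofReal, abs_mul, abs_of_pos hL]
    rw [him] at h1
    have hE := Real.exp_pos (|ρ.im| * L)
    have hCρ := hC ρ
    generalize Real.exp (|ρ.im| * L) = E at h1 hE hCρ ⊢
    have h2 : C * E / (1 + ‖ρ‖) ≤ c / 2 * E := by
      rw [div_le_iff₀ (by positivity)]
      rw [div_le_iff₀ hc] at hρ
      have h3 : C ≤ c / 2 * (1 + ‖ρ‖) := by linarith [le_abs_self C]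
      nlinarith
    have h3 := norm_sub_norm_le (Complex.sin (ρ * L)) (ρ * f ρ)
    rw [norm_sub_rev, norm_mul] at h3
    rw [div_le_iff₀ (by positivity)]
    have := hCρ.trans h2
    nlinarith [norm_nonneg (f ρ)]
  obtain ⟨K, hK⟩ := exists_nat_ge (2 * |C| / c / h + 1 / 2)
  -- The circle of radius `R` runs midway between lattice points, at distance at least `h/2` from
  -- all of them, and beyond the threshold `2|C|/c` where the error is at most half the sine.
  set R : ℝ := (K - 1 / 2) * h with hR
  have hR0 : 2 * |C| / c ≤ R := by
    rw [hR, ← div_le_iff₀ hh0]; linarith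
  have hlow : ∀ ρ : ℂ, R ≤ ‖ρ‖ → (∀ k : ℤ, (K : ℤ) ≤ |k| → r ≤ ‖ρ - ((k * h : ℝ) : ℂ)‖) →
      c / 2 * Real.exp (|ρ.im| * L) / (1 + ‖ρ‖) ≤ ‖f ρ‖ := fun ρ hρ hk =>
    hoff ρ (hR0.trans hρ) fun k => by
      by_cases hkK : (K : ℤ) ≤ |k|
      · exact hk k hkK
      · have h1 : |(k : ℝ)| + 1 ≤ K := by exact_mod_cast not_le.1 hkK
        have h2 := norm_sub_norm_le ρ ((k * h : ℝ) : ℂ)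
        rw [hnode] at h2
        nlinarith
  have hfar : ∀ k : ℤ, (K : ℤ) ≤ |k| → R + h / 2 ≤ ‖((k * h : ℝ) : ℂ)‖ := fun k hk => by
    have h1 : (K : ℝ) ≤ |(k : ℝ)| := by exact_mod_cast hk
    rw [hnode]
    nlinarith
  have hcircle : ∀ ρ : ℂ, ‖ρ‖ = R → 0 < ‖f ρ‖ := fun ρ hρ =>
    lt_of_lt_of_le (by positivity) (hlow ρ hρ.ge fun k hk => by
      have h1 := hfar k hk
      have h2 := norm_sub_norm_le ((k * h : ℝ) : ℂ) ρ
      rw [norm_sub_rev] at h2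
      linarith)
  have hRpos : 0 ≤ R := le_trans (by positivity) hR0
  set Z : Set ℂ := {z ∈ Metric.closedBall 0 R | f z = 0} with hZ
  have hZfin : Z.Finite := by
    have h1 : ‖(R : ℂ)‖ = R := by rw [Complex.norm_real, Real.norm_of_nonneg hRpos]
    exact hf.finite_zeros_of_isCompact (norm_pos_iff.1 (hcircle R h1)) (isCompact_closedBall 0 R)
  have hZR : ∀ z ∈ Z, ‖z‖ < R := fun z hz => by
    refine lt_of_le_of_ne (by simpa using hz.1) fun h1 => ?_
    have := hcircle z h1
    rw [hz.2, norm_zero] at this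
    exact lt_irrefl _ this
  obtain ⟨s, hs0, hsε, hsR, hsd⟩ := hZfin.exists_radius (half_pos hε) hZR
  have hcomp : IsCompact (Metric.closedBall (0 : ℂ) R \ ⋃ z ∈ Z, Metric.ball z s) :=
    (isCompact_closedBall 0 R).diff (isOpen_biUnion fun _ _ => Metric.isOpen_ball)
  obtain ⟨m, hm0, hm⟩ := hcomp.exists_forall_le' (f := fun z => ‖f z‖) (a := 0)
    hf.continuous.norm.continuousOn fun z hz => norm_pos_iff.2 fun h0 =>
      hz.2 (mem_biUnion (show z ∈ Z from ⟨hz.1, h0⟩) (Metric.mem_ball_self hs0))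
  -- `c/4` beats the lower bound with `c/2` outside radius `R`; the other term beats the lower bound
  -- `m` of `|f|` inside, where the exponential is at most `exp (R L)`.
  refine ⟨min (c / 4) (m * Real.exp (-(R * L)) / 2), by positivity, fun g hg hfg => ?_⟩
  refine exists_equiv_zeroWithMultiplicity (ι := Z ⊕ {k : ℤ // (K : ℤ) ≤ |k|})
    (c := Sum.elim (fun z => z.1) fun k => ((k.1 * h : ℝ) : ℂ))
    (r := Sum.elim (fun _ => s) fun _ => r) ?_ ?_ ?_ hf hg ?_
  · rintro (i | i)
    · exact hs0
    · exact hr0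
  · rintro (i | i)
    · exact hsε
    · exact min_le_left _ _
  · have hmixed : ∀ (z : Z) (k : {k : ℤ // (K : ℤ) ≤ |k|}),
        Disjoint (Metric.closedBall z.1 s) (Metric.closedBall ((k.1 * h : ℝ) : ℂ) r) :=
      fun z k => by
      refine Metric.closedBall_disjoint_closedBall ?_
      have h1 := hfar k.1 k.2
      have h2 := hsR z.1 z.2
      have h3 := norm_sub_norm_le ((k.1 * h : ℝ) : ℂ) z.1
      rw [dist_comm, dist_eq_norm]
      linarith
    rintro (z | k) (w | l) hne
    · exact Metric.closedBall_disjoint_closedBall (hsd z.1 z.2 w.1 w.2 fun h1 =>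
        hne (congrArg Sum.inl (Subtype.ext h1)))
    · exact hmixed z l
    · exact (hmixed w k).symm
    · refine Metric.closedBall_disjoint_closedBall ?_
      have h1 : k.1 - l.1 ≠ 0 := sub_ne_zero.2 fun h1 => hne (congrArg Sum.inr (Subtype.ext h1))
      have h2 : (1 : ℝ) ≤ |((k.1 - l.1 : ℤ) : ℝ)| := by exact_mod_cast Int.one_le_abs h1
      have h3 : ((k.1 * h : ℝ) : ℂ) - ((l.1 * h : ℝ) : ℂ) = (((k.1 - l.1 : ℤ) * h : ℝ) : ℂ) := by
        push_cast; ring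
      change r + r < dist ((k.1 * h : ℝ) : ℂ) ((l.1 * h : ℝ) : ℂ)
      rw [dist_eq_norm, h3, hnode]
      nlinarith
  · intro z hz
    rw [norm_sub_rev]
    have hE := Real.exp_pos (|z.im| * L)
    rcases le_total R ‖z‖ with hzR | hzR
    · refine lt_of_lt_of_le ?_ (hlow z hzR fun k hk => ?_)
      · refine (hfg z).trans_lt ?_
        gcongr
        exact (min_le_left _ _).trans_lt (by linarith)
      · have h1 := hz (Sum.inr ⟨k, hk⟩)
        change z ∉ Metric.ball ((k * h : ℝ) : ℂ) r at h1
        rwa [Metric.mem_ball, not_lt, dist_eq_norm] at h1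
    · refine lt_of_lt_of_le ?_ (hm z ⟨by simpa using hzR, fun h1 => ?_⟩)
      · refine (hfg z).trans_lt ?_
        have h1 : Real.exp (|z.im| * L) ≤ Real.exp (R * L) := by
          gcongr
          exact (Complex.abs_im_le_norm z).trans hzR
        calc _ ≤ min (c / 4) (m * Real.exp (-(R * L)) / 2) * Real.exp (|z.im| * L) :=
              div_le_self (by positivity) (by linarith [norm_nonneg z])
          _ ≤ m * Real.exp (-(R * L)) / 2 * Real.exp (R * L) := by
              gcongr
              exact min_le_right _ _
          _ = m / 2 := by
              rw [Real.exp_neg]; field_simp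
          _ < m := by linarith
      · simp only [mem_iUnion] at h1
        obtain ⟨w, hw, hzw⟩ := h1
        exact hz (Sum.inl ⟨w, hw⟩) hzw

/-! ### Absolutely continuous functions. -/

/-- A function whose increments are dominated by those of an absolutely continuous function is
absolutely continuous. -/
theorem AbsolutelyContinuousOnInterval.of_dist_le {X Y : Type*} [PseudoMetricSpace X]
    [PseudoMetricSpace Y] {f : ℝ → X} {g : ℝ → Y} {a b : ℝ}
    (hg : AbsolutelyContinuousOnInterval g a b)
    (h : ∀ x ∈ uIcc a b, ∀ y ∈ uIcc a b, dist (f x) (f y) ≤ dist (g x) (g y)) :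
    AbsolutelyContinuousOnInterval f a b := by
  rw [absolutelyContinuousOnInterval_iff] at hg ⊢
  intro ε hε
  obtain ⟨δ, hδ, hδε⟩ := hg ε hε
  refine ⟨δ, hδ, fun E hE hEδ => lt_of_le_of_lt (Finset.sum_le_sum fun i hi => ?_) (hδε E hE hEδ)⟩
  have := hE.1 i hi
  exact h _ this.1 _ this.2

theorem IntervalIntegrable.absolutelyContinuousOnInterval_integral {w : ℝ → ℂ} {a b : ℝ}
    (hw : IntervalIntegrable w volume a b) :
    AbsolutelyContinuousOnInterval (fun x => ∫ t in a..x, w t) a b := by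
  refine AbsolutelyContinuousOnInterval.of_dist_le
    (hw.norm.absolutelyContinuousOnInterval_intervalIntegral left_mem_uIcc) fun x hx y hy => ?_
  have hx' : IntervalIntegrable w volume a x := hw.mono_set (uIcc_subset_uIcc_left hx)
  have hy' : IntervalIntegrable w volume a y := hw.mono_set (uIcc_subset_uIcc_left hy)
  rw [dist_eq_norm, dist_eq_norm, intervalIntegral.integral_interval_sub_left hx' hy',
    intervalIntegral.integral_interval_sub_left hx'.norm hy'.norm, Real.norm_eq_abs]
  exact intervalIntegral.norm_integral_le_abs_integral_norm

/-- The fundamental theorem of calculus for absolutely continuous functions with a given almost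
everywhere derivative. -/
theorem AbsolutelyContinuousOnInterval.sub_eq_integral {f w : ℝ → ℂ} {L : ℝ} (hL : 0 ≤ L)
    (hf : AbsolutelyContinuousOnInterval f 0 L) (hw : IntervalIntegrable w volume 0 L)
    (hd : ∀ᵐ x ∂volume.restrict (Ioo 0 L), HasDerivAt f (w x) x) {x : ℝ} (hx : x ∈ Icc 0 L) :
    f x - f 0 = ∫ t in 0..x, w t := by
  have hae : ∀ᵐ x, x ∈ uIcc 0 L → HasDerivAt (fun x => f x - ∫ t in 0..x, w t) 0 x := by
    rw [ae_restrict_iff' measurableSet_Ioo] at hd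
    have h0 : ∀ᵐ x : ℝ, x ≠ 0 := by simp [ae_iff, measure_singleton]
    have h1 : ∀ᵐ x : ℝ, x ≠ L := by simp [ae_iff, measure_singleton]
    filter_upwards [hd, hw.ae_hasDerivAt_integral, h0, h1] with x hx1 hx2 hx3 hx4 hx
    have hx' := hx
    rw [uIcc_of_le hL] at hx'
    exact ((hx1 ⟨lt_of_le_of_ne hx'.1 hx3.symm, lt_of_le_of_ne hx'.2 hx4⟩).sub
      (hx2 hx 0 left_mem_uIcc)).congr_deriv (sub_self _)
  obtain ⟨C, hC⟩ := (hf.fun_sub hw.absolutelyContinuousOnInterval_integral).const_of_ae_hasDerivAt_zero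
    hae
  rw [uIcc_of_le hL] at hC
  have h0 := hC 0 ⟨le_rfl, hL⟩
  have h1 := hC x hx
  rw [intervalIntegral.integral_same, sub_zero] at h0
  rw [h0, ← h1]; ring

theorem AbsolutelyContinuousOnInterval.of_continuous_deriv {f f' : ℝ → ℂ} {L : ℝ} (hL : 0 ≤ L)
    (hf : ∀ x ∈ Icc 0 L, HasDerivWithinAt f (f' x) (Icc 0 L) x) (hf' : ContinuousOn f' (Icc 0 L)) :
    AbsolutelyContinuousOnInterval f 0 L := by
  obtain ⟨C, hC⟩ := isCompact_Icc.exists_bound_of_continuousOn hf'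
  have hlip : LipschitzOnWith (Real.toNNReal C) f (uIcc 0 L) := by
    rw [uIcc_of_le hL]
    exact (convex_Icc 0 L).lipschitzOnWith_of_nnnorm_hasDerivWithin_le hf fun x hx => by
      rw [← NNReal.coe_le_coe, coe_nnnorm]
      exact (hC x hx).trans (Real.le_coe_toNNReal C)
  exact hlip.absolutelyContinuousOnInterval

/-! ### The Volterra integral equation. -/

/-- The function `sin (ρ x) / ρ`, extended to `ρ = 0`. -/
noncomputable def sineKernel (ρ : ℂ) (x : ℝ) : ℂ := ∫ u in (0 : ℝ)..x, Complex.cos (ρ * u)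

theorem continuous_cos_mul (ρ : ℂ) : Continuous fun u : ℝ => Complex.cos (ρ * u) := by fun_prop

theorem hasDerivAt_cos_mul (ρ : ℂ) (x : ℝ) :
    HasDerivAt (fun u : ℝ => Complex.cos (ρ * u)) (-(ρ * Complex.sin (ρ * x))) x := by
  have h := (((hasDerivAt_id (x : ℂ)).const_mul ρ).ccos).comp_ofReal
  refine h.congr_deriv ?_
  simp; ring

theorem hasDerivAt_sineKernel (ρ : ℂ) (x : ℝ) :
    HasDerivAt (sineKernel ρ) (Complex.cos (ρ * x)) x :=
  ((continuous_cos_mul ρ).integral_hasStrictDerivAt 0 x).hasDerivAt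

theorem continuous_sineKernel (ρ : ℂ) : Continuous (sineKernel ρ) :=
  continuous_iff_continuousAt.2 fun x => (hasDerivAt_sineKernel ρ x).continuousAt

theorem mul_sineKernel (ρ : ℂ) (x : ℝ) : ρ * sineKernel ρ x = Complex.sin (ρ * x) := by
  have h : ∀ u ∈ uIcc 0 x, HasDerivAt (fun u : ℝ => Complex.sin (ρ * u))
      (ρ * Complex.cos (ρ * u)) u := fun u _ => by
    refine (((hasDerivAt_id (u : ℂ)).const_mul ρ).csin).comp_ofReal.congr_deriv ?_
    simp; ring
  have := intervalIntegral.integral_eq_sub_of_hasDerivAt h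
    (((continuous_cos_mul ρ).const_mul ρ).intervalIntegrable _ _)
  rw [intervalIntegral.integral_const_mul] at this
  simpa [sineKernel] using this

theorem sineKernel_zero_right (ρ : ℂ) : sineKernel ρ 0 = 0 := intervalIntegral.integral_same

theorem sineKernel_zero_left (x : ℝ) : sineKernel 0 x = x := by simp [sineKernel]

theorem sineKernel_neg (ρ : ℂ) (x : ℝ) : sineKernel (-ρ) x = sineKernel ρ x := by
  simp [sineKernel]

/-- Separates the variables of the Volterra kernel, so that the integral operator becomes a
combination of multiplications and one fixed primitive that does not involve `ρ`. -/
theorem sineKernel_sub (ρ : ℂ) (x t : ℝ) : sineKernel ρ (x - t) =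
    sineKernel ρ x * Complex.cos (ρ * t) - Complex.cos (ρ * x) * sineKernel ρ t := by
  by_cases hρ : ρ = 0
  · subst hρ; simp [sineKernel_zero_left]
  · refine mul_left_cancel₀ hρ ?_
    have h1 := mul_sineKernel ρ x
    have h2 := mul_sineKernel ρ t
    have h3 : Complex.sin (ρ * ((x - t : ℝ) : ℂ)) = Complex.sin (ρ * x) * Complex.cos (ρ * t) -
        Complex.cos (ρ * x) * Complex.sin (ρ * t) := by
      rw [← Complex.sin_sub]; push_cast; ring_nf
    rw [mul_sineKernel, h3]
    linear_combination Complex.cos (ρ * x) * h2 - Complex.cos (ρ * t) * h1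

theorem norm_cos_mul_le (ρ : ℂ) {u x : ℝ} (hu : 0 ≤ u) (hux : u ≤ x) :
    ‖Complex.cos (ρ * u)‖ ≤ Real.exp (|ρ.im| * x) := by
  refine (Complex.norm_cos_le_exp _).trans (Real.exp_le_exp.2 ?_)
  rw [Complex.im_mul_ofReal, abs_mul, abs_of_nonneg hu]
  gcongr

theorem norm_sineKernel_le (ρ : ℂ) {x : ℝ} (hx : 0 ≤ x) :
    ‖sineKernel ρ x‖ ≤ Real.exp (|ρ.im| * x) * x := by
  have := intervalIntegral.norm_integral_le_of_norm_le_const (a := 0) (b := x)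
    (f := fun u : ℝ => Complex.cos (ρ * u)) (C := Real.exp (|ρ.im| * x)) fun u hu => by
      rw [uIoc_of_le hx] at hu
      exact norm_cos_mul_le ρ hu.1.le hu.2
  rwa [sub_zero, abs_of_nonneg hx] at this

theorem norm_mul_norm_sineKernel_le (ρ : ℂ) {x : ℝ} (hx : 0 ≤ x) :
    ‖ρ‖ * ‖sineKernel ρ x‖ ≤ Real.exp (|ρ.im| * x) := by
  rw [← norm_mul, mul_sineKernel]
  refine (Complex.norm_sin_le_exp _).trans_eq ?_
  rw [Complex.im_mul_ofReal, abs_mul, abs_of_nonneg hx]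

/-- The Volterra integral equation satisfied by the sine-type solution. -/
def IsVolterraSolution (q : ℝ → ℂ) (L : ℝ) (ρ : ℂ) (y : ℝ → ℂ) : Prop :=
  ContinuousOn y (Icc 0 L) ∧ ∀ x ∈ Icc 0 L,
    y x = sineKernel ρ x + ∫ t in 0..x, sineKernel ρ (x - t) * (q t * y t)

theorem intervalIntegrable_mul_continuousOn {q y : ℝ → ℂ} {L : ℝ} (hL : 0 ≤ L)
    (hq : IntervalIntegrable q volume 0 L) (hy : ContinuousOn y (Icc 0 L)) :
    IntervalIntegrable (fun t => q t * y t) volume 0 L :=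
  hq.mul_continuousOn (by rwa [uIcc_of_le hL])

/-- Variation of constants: `t ↦ cos(ρ(x-t)) y(t) + sineKernel ρ (x-t) v(t)` has almost everywhere
the derivative `sineKernel ρ (x-t) q(t) y(t)`, equals `y x` at `t = x`, and equals `sineKernel ρ x`
at `t = 0`. -/
theorem IsSineSolution.isVolterraSolution {q : ℝ → ℂ} {L : ℝ} (hL : 0 ≤ L)
    (hq : IntervalIntegrable q volume 0 L) {ρ : ℂ} {y : ℝ → ℂ} (h : IsSineSolution q L ρ y) :
    IsVolterraSolution q L ρ y := by
  obtain ⟨v, hyv, hv, heq, hy0, hv0⟩ := h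
  have hyc : ContinuousOn y (Icc 0 L) := fun x hx => (hyv x hx).continuousWithinAt
  have hvc : ContinuousOn v (Icc 0 L) := by simpa [uIcc_of_le hL] using hv.continuousOn
  have hyac := AbsolutelyContinuousOnInterval.of_continuous_deriv hL hyv hvc
  refine ⟨hyc, fun x hx => ?_⟩
  have hsub : ∀ t : ℝ, HasDerivAt (fun t : ℝ => x - t) (-1) t := fun t => by
    simpa using (hasDerivAt_id t).const_sub x
  have hS : ∀ t : ℝ, HasDerivAt (fun t => sineKernel ρ (x - t))
      (-Complex.cos (ρ * ((x - t : ℝ) : ℂ))) t := fun t => by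
    exact ((hasDerivAt_sineKernel ρ (x - t)).scomp t (hsub t)).congr_deriv (by simp)
  have hC : ∀ t : ℝ, HasDerivAt (fun t : ℝ => Complex.cos (ρ * ((x - t : ℝ) : ℂ)))
      (ρ * Complex.sin (ρ * ((x - t : ℝ) : ℂ))) t := fun t => by
    exact ((hasDerivAt_cos_mul ρ (x - t)).scomp t (hsub t)).congr_deriv (by simp)
  have hCac : AbsolutelyContinuousOnInterval (fun t : ℝ => Complex.cos (ρ * ((x - t : ℝ) : ℂ))) 0 L :=
    .of_continuous_deriv hL (fun t _ => (hC t).hasDerivWithinAt) (by fun_prop)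
  have hSac : AbsolutelyContinuousOnInterval (fun t => sineKernel ρ (x - t)) 0 L :=
    .of_continuous_deriv hL (fun t _ => (hS t).hasDerivWithinAt) (by fun_prop)
  have hac := (hCac.fun_smul hyac).fun_add (hSac.fun_smul hv)
  have hint : IntervalIntegrable (fun t => sineKernel ρ (x - t) * (q t * y t)) volume 0 L :=
    (intervalIntegrable_mul_continuousOn hL hq hyc).continuousOn_mul
      (((continuous_sineKernel ρ).comp (by fun_prop)).continuousOn)
  have hd : ∀ᵐ t ∂volume.restrict (Ioo 0 L),
      HasDerivAt (fun t => Complex.cos (ρ * ((x - t : ℝ) : ℂ)) • y t + sineKernel ρ (x - t) • v t)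
        (sineKernel ρ (x - t) * (q t * y t)) t := by
    filter_upwards [heq, ae_restrict_mem measurableSet_Ioo] with t ⟨w, hw, hwq⟩ ht
    have hyt : HasDerivAt y (v t) t :=
      (hyv t (Ioo_subset_Icc_self ht)).hasDerivAt (Icc_mem_nhds ht.1 ht.2)
    refine (((hC t).mul hyt).add ((hS t).mul hw)).congr_deriv ?_
    rw [← mul_sineKernel]
    linear_combination -sineKernel ρ (x - t) * hwq
  have := hac.sub_eq_integral hL hint hd hx
  simp only [sub_self, sub_zero, hy0, hv0, sineKernel_zero_right, smul_eq_mul] at this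
  rw [← this]; simp

theorem IsVolterraSolution.isSineSolution {q : ℝ → ℂ} {L : ℝ} (hL : 0 < L)
    (hq : IntervalIntegrable q volume 0 L) {ρ : ℂ} {y : ℝ → ℂ}
    (h : IsVolterraSolution q L ρ y) :
    ∃ z : ℝ → ℂ, IsSineSolution q L ρ z := by
  have hqy := intervalIntegrable_mul_continuousOn hL.le hq h.1
  have hAi : IntervalIntegrable (fun t : ℝ => Complex.cos (ρ * t) * (q t * y t)) volume 0 L :=
    hqy.continuousOn_mul (continuous_cos_mul ρ).continuousOn
  have hBi : IntervalIntegrable (fun t => sineKernel ρ t * (q t * y t)) volume 0 L :=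
    hqy.continuousOn_mul (continuous_sineKernel ρ).continuousOn
  set A : ℝ → ℂ := fun x => ∫ t in 0..x, Complex.cos (ρ * t) * (q t * y t) with hA
  set B : ℝ → ℂ := fun x => ∫ t in 0..x, sineKernel ρ t * (q t * y t) with hB
  have hAac : AbsolutelyContinuousOnInterval A 0 L := hAi.absolutelyContinuousOnInterval_integral
  have hBac : AbsolutelyContinuousOnInterval B 0 L := hBi.absolutelyContinuousOnInterval_integral
  have hCac : AbsolutelyContinuousOnInterval (fun t : ℝ => Complex.cos (ρ * t)) 0 L :=
    .of_continuous_deriv hL.le (fun t _ => (hasDerivAt_cos_mul ρ t).hasDerivWithinAt) (by fun_prop)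
  have hSac : AbsolutelyContinuousOnInterval (sineKernel ρ) 0 L :=
    .of_continuous_deriv hL.le (fun t _ => (hasDerivAt_sineKernel ρ t).hasDerivWithinAt)
      (by fun_prop)
  set z : ℝ → ℂ := fun x => sineKernel ρ x + (sineKernel ρ x • A x - Complex.cos (ρ * x) • B x)
    with hz
  set v : ℝ → ℂ := fun x => Complex.cos (ρ * x) + (Complex.cos (ρ * x) • A x +
    ρ ^ 2 • (sineKernel ρ x • B x)) with hv
  have hzac : AbsolutelyContinuousOnInterval z 0 L :=
    hSac.fun_add ((hSac.fun_smul hAac).fun_sub (hCac.fun_smul hBac))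
  have hvac : AbsolutelyContinuousOnInterval v 0 L :=
    hCac.fun_add ((hCac.fun_smul hAac).fun_add ((hSac.fun_smul hBac).const_smul (ρ ^ 2)))
  have hzy : ∀ x ∈ Icc 0 L, z x = y x := fun x hx => by
    have hsub : uIcc 0 x ⊆ uIcc 0 L := uIcc_subset_uIcc_left (by rwa [uIcc_of_le hL.le])
    rw [h.2 x hx, hz]
    simp only [smul_eq_mul, hA, hB]
    rw [← intervalIntegral.integral_const_mul, ← intervalIntegral.integral_const_mul,
      ← intervalIntegral.integral_sub ((hAi.mono_set hsub).const_mul _)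
        ((hBi.mono_set hsub).const_mul _)]
    congr 1
    refine intervalIntegral.integral_congr fun t _ => ?_
    simp only [sineKernel_sub]
    ring
  have hderiv : ∀ᵐ x ∂volume.restrict (Ioo 0 L), HasDerivAt z (v x) x ∧
      HasDerivAt v (q x * y x - ρ ^ 2 * z x) x := by
    rw [ae_restrict_iff' measurableSet_Ioo]
    filter_upwards [hAi.ae_hasDerivAt_integral, hBi.ae_hasDerivAt_integral] with x hx1 hx2 hx
    have hx' : x ∈ uIcc 0 L := by rw [uIcc_of_le hL.le]; exact Ioo_subset_Icc_self hx
    have hA' := hx1 hx' 0 left_mem_uIcc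
    have hB' := hx2 hx' 0 left_mem_uIcc
    have hS := hasDerivAt_sineKernel ρ x
    have hC := hasDerivAt_cos_mul ρ x
    have h1 : Complex.sin (ρ * x) = ρ * sineKernel ρ x := (mul_sineKernel ρ x).symm
    have h2 : ρ ^ 2 * sineKernel ρ x ^ 2 + Complex.cos (ρ * x) ^ 2 = 1 := by
      rw [← Complex.sin_sq_add_cos_sq (ρ * x), h1]; ring
    constructor
    · refine (hS.add ((hS.mul hA').sub (hC.mul hB'))).congr_deriv ?_
      simp only [hv, smul_eq_mul, h1, hA, hB]
      ring
    · refine (hC.add ((hC.mul hA').add ((hS.mul hB').const_mul (ρ ^ 2)))).congr_deriv ?_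
      simp only [hz, smul_eq_mul, h1, hA, hB]
      linear_combination (q x * y x) * h2
  have hvc : ContinuousOn v (Icc 0 L) := by simpa [uIcc_of_le hL.le] using hvac.continuousOn
  have hvi : IntervalIntegrable v volume 0 L := (hvac.continuousOn).intervalIntegrable
  have hz0 : z 0 = 0 := by simp [hz, hB, sineKernel_zero_right]
  -- Since `v` is continuous, this upgrades `z' = v` from almost everywhere to every point of `[0,
  -- L]`, end points included.
  have hzint : ∀ x ∈ Icc 0 L, z x = ∫ t in 0..x, v t := fun x hx => by
    have := hzac.sub_eq_integral hL.le hvi (hderiv.mono fun x hx => hx.1) hx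
    rwa [hz0, sub_zero] at this
  refine ⟨z, v, fun x hx => ?_, hvac, ?_, hz0, by simp [hv, hA, sineKernel_zero_right]⟩
  · have : Fact (x ∈ Icc 0 L) := ⟨hx⟩
    have h1 : HasDerivWithinAt (fun u => ∫ t in 0..u, v t) (v x) (Icc 0 L) x :=
      intervalIntegral.integral_hasDerivWithinAt_right
        (hvi.mono_set (uIcc_subset_uIcc_left (by rwa [uIcc_of_le hL.le])))
        (hvc.stronglyMeasurableAtFilter_nhdsWithin measurableSet_Icc x) (hvc x hx)
    exact h1.congr hzint (hzint x hx)
  · filter_upwards [hderiv, ae_restrict_mem measurableSet_Ioo] with x hx hxI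
    refine ⟨_, hx.2, ?_⟩
    rw [hzy x (Ioo_subset_Icc_self hxI)]
    ring

/-! ### The Volterra operator and its resolvent. -/

theorem differentiable_mul_comp_mul_sub {X : Type*} [NormedCommRing X] [NormedAlgebra ℂ X]
    (V : X →L[ℂ] X) {a b : ℂ → X} (ha : Differentiable ℂ a) (hb : Differentiable ℂ b) :
    Differentiable ℂ fun z =>
      (ContinuousLinearMap.mul ℂ X (a z)).comp (V.comp (ContinuousLinearMap.mul ℂ X (b z))) -
      (ContinuousLinearMap.mul ℂ X (b z)).comp (V.comp (ContinuousLinearMap.mul ℂ X (a z))) := by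
  have h1 := (ContinuousLinearMap.mul ℂ X).differentiable.comp ha
  have h2 := (ContinuousLinearMap.mul ℂ X).differentiable.comp hb
  exact (h1.clm_comp ((differentiable_const V).clm_comp h2)).fun_sub
    (h2.clm_comp ((differentiable_const V).clm_comp h1))

/-- If a power of `t` is small then `1 - t` is invertible. -/
theorem ContinuousLinearMap.isUnit_one_sub_of_norm_pow_lt_one {X : Type*} [NormedAddCommGroup X]
    [NormedSpace ℂ X] [CompleteSpace X] {t : X →L[ℂ] X} {k : ℕ} (h : ‖t ^ k‖ < 1) :
    IsUnit (1 - t) := by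
  have hu : IsUnit (1 - t ^ k) := _root_.isUnit_one_sub_of_norm_lt_one (R := X →L[ℂ] X) h
  have hcomm : Commute (1 - t) (∑ i ∈ Finset.range k, t ^ i) :=
    Commute.sum_right _ _ _ fun i _ => (Commute.one_left _).sub_left (Commute.self_pow t i)
  rw [← mul_neg_geom_sum] at hu
  exact (hcomm.isUnit_mul_iff.1 hu).1

theorem differentiable_inverse_one_sub_apply {X : Type*} [NormedAddCommGroup X] [NormedSpace ℂ X]
    [CompleteSpace X] {T : ℂ → X →L[ℂ] X} (hT : Differentiable ℂ T)
    (hu : ∀ z, IsUnit (1 - T z)) {f : ℂ → X} (hf : Differentiable ℂ f) :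
    Differentiable ℂ fun z => Ring.inverse (1 - T z) (f z) := fun z => by
  have h1 : DifferentiableAt ℂ (fun z => 1 - T z) z := (differentiableAt_const _).sub (hT z)
  have h2 : DifferentiableAt ℂ (fun z => Ring.inverse (1 - T z)) z :=
    DifferentiableAt.comp (g := Ring.inverse) z (differentiableAt_inverse (hu z)) h1
  exact h2.clm_apply (hf z)

section VolterraOperator

variable {L : ℝ} (hL : 0 ≤ L) {w : ℝ → ℂ} (hw : IntervalIntegrable w volume 0 L)

theorem intervalIntegrable_mul_IccExtend (hL : 0 ≤ L) {w : ℝ → ℂ}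
    (hw : IntervalIntegrable w volume 0 L) (f : C(Icc 0 L, ℂ)) :
    IntervalIntegrable (fun t => w t * IccExtend hL f t) volume 0 L :=
  intervalIntegrable_mul_continuousOn hL hw (f.continuous.Icc_extend' (h := hL)).continuousOn

theorem continuous_integral_mul_IccExtend (hL : 0 ≤ L) {w : ℝ → ℂ}
    (hw : IntervalIntegrable w volume 0 L) (f : C(Icc 0 L, ℂ)) :
    Continuous fun x : Icc 0 L => ∫ t in 0..(x : ℝ), w t * IccExtend hL f t := by
  have h := (intervalIntegrable_mul_IccExtend hL hw
    f).absolutelyContinuousOnInterval_integral.continuousOn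
  rw [uIcc_of_le hL] at h
  exact continuousOn_iff_continuous_domRestrict.1 h

/-- The operator `f ↦ ∫ t in 0..x, w t * f t` on continuous functions. -/
noncomputable def weightedPrimitive : C(Icc 0 L, ℂ) →L[ℂ] C(Icc 0 L, ℂ) :=
  LinearMap.mkContinuous
    { toFun := fun f => ⟨fun x => ∫ t in 0..(x : ℝ), w t * IccExtend hL f t,
        continuous_integral_mul_IccExtend hL hw f⟩
      map_add' := fun f g => by
        ext x
        have hsub : uIcc 0 (x : ℝ) ⊆ uIcc 0 L :=
          uIcc_subset_uIcc_left (by rw [uIcc_of_le hL]; exact x.2)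
        simp only [ContinuousMap.coe_mk, ContinuousMap.add_apply]
        rw [← intervalIntegral.integral_add
          ((intervalIntegrable_mul_IccExtend hL hw f).mono_set hsub)
          ((intervalIntegrable_mul_IccExtend hL hw g).mono_set hsub)]
        refine intervalIntegral.integral_congr fun t _ => ?_
        simp [IccExtend, mul_add]
      map_smul' := fun c f => by
        ext x
        simp only [ContinuousMap.coe_mk, ContinuousMap.smul_apply, RingHom.id_apply, smul_eq_mul]
        rw [← intervalIntegral.integral_const_mul]
        refine intervalIntegral.integral_congr fun t _ => ?_
        simp only [IccExtend, Function.comp_apply, ContinuousMap.smul_apply, smul_eq_mul]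
        ring }
    (∫ t in 0..L, ‖w t‖) fun f => by
      have h0 : 0 ≤ ∫ t in 0..L, ‖w t‖ :=
        intervalIntegral.integral_nonneg hL fun _ _ => norm_nonneg _
      refine (ContinuousMap.norm_le _ (by positivity)).2 fun x => ?_
      have hsub : uIcc 0 (x : ℝ) ⊆ uIcc 0 L :=
        uIcc_subset_uIcc_left (by rw [uIcc_of_le hL]; exact x.2)
      calc ‖∫ t in 0..(x : ℝ), w t * IccExtend hL f t‖
          ≤ ∫ t in 0..(x : ℝ), ‖w t‖ * ‖f‖ :=
            intervalIntegral.norm_integral_le_of_norm_le x.2.1 (ae_of_all _ fun t _ => by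
              rw [norm_mul]
              exact mul_le_mul_of_nonneg_left (f.norm_coe_le_norm _) (norm_nonneg _))
              ((hw.mono_set hsub).norm.mul_const _)
        _ = (∫ t in 0..(x : ℝ), ‖w t‖) * ‖f‖ := intervalIntegral.integral_mul_const _ _
        _ ≤ _ := by
          gcongr
          exact intervalIntegral.integral_mono_interval le_rfl x.2.1 x.2.2
            (ae_of_all _ fun _ => norm_nonneg _) hw.norm

theorem weightedPrimitive_apply (f : C(Icc 0 L, ℂ)) (x : Icc 0 L) :
    weightedPrimitive hL hw f x = ∫ t in 0..(x : ℝ), w t * IccExtend hL f t := rfl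

end VolterraOperator

/-- The function `x ↦ cos (ρ x)` on `[0, L]`. -/
noncomputable def cosMap (L : ℝ) (ρ : ℂ) : C(Icc 0 L, ℂ) := ⟨fun x => Complex.cos (ρ * (x : ℝ)),
  (continuous_cos_mul ρ).comp continuous_subtype_val⟩

/-- The function `x ↦ sin (ρ x) / ρ` on `[0, L]`. -/
noncomputable def sineMap (L : ℝ) (ρ : ℂ) : C(Icc 0 L, ℂ) := ⟨fun x => sineKernel ρ x,
  (continuous_sineKernel ρ).comp continuous_subtype_val⟩

/-- In the Banach algebra of continuous functions, `cos (ρ x)` is the mean of `exp (ρ X)` and `exp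
(-ρ X)` with `X = i x`, and these are entire in `ρ`. -/
theorem differentiable_cosMap (L : ℝ) : Differentiable ℂ (cosMap L) := by
  let X : C(Icc 0 L, ℂ) := ⟨fun x => Complex.I * ((x : ℝ) : ℂ), by fun_prop⟩
  have h : cosMap L = fun ρ : ℂ =>
      (2⁻¹ : ℂ) • (NormedSpace.exp (ρ • X) + NormedSpace.exp (ρ • (-X))) := by
    funext ρ
    ext x
    have hev : ∀ g : C(Icc 0 L, ℂ), (NormedSpace.exp g) x = Complex.exp (g x) := fun g => by
      rw [Complex.exp_eq_exp_ℂ]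
      exact NormedSpace.map_exp (ContinuousMap.evalAlgHom ℂ ℂ x) (continuous_eval_const x) g
    simp only [ContinuousMap.smul_apply, ContinuousMap.add_apply, hev, ContinuousMap.neg_apply]
    change Complex.cos (ρ * (x : ℝ)) = (2⁻¹ : ℂ) • (Complex.exp (ρ • (Complex.I * ((x : ℝ) : ℂ))) +
      Complex.exp (ρ • -(Complex.I * ((x : ℝ) : ℂ))))
    simp only [Complex.cos, smul_eq_mul]
    ring_nf
  rw [h]
  intro ρ
  exact ((hasDerivAt_exp_smul_const X ρ).differentiableAt.fun_add
    (hasDerivAt_exp_smul_const (-X) ρ).differentiableAt).fun_const_smul _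

theorem differentiable_sineMap {L : ℝ} (hL : 0 ≤ L) : Differentiable ℂ (sineMap L) := by
  have h1 : IntervalIntegrable (fun _ : ℝ => (1 : ℂ)) volume 0 L := intervalIntegrable_const
  have h : sineMap L = fun ρ => weightedPrimitive hL h1 (cosMap L ρ) := by
    funext ρ
    ext x
    rw [weightedPrimitive_apply]
    refine intervalIntegral.integral_congr fun t ht => ?_
    rw [uIcc_of_le x.2.1] at ht
    simp only [one_mul]
    rw [IccExtend_of_mem hL _ ⟨ht.1, ht.2.trans x.2.2⟩]
    rfl
  rw [h]
  exact (weightedPrimitive hL h1).differentiable.comp (differentiable_cosMap L)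

section Resolvent

variable {q : ℝ → ℂ} {L : ℝ} (hL : 0 ≤ L) (hq : IntervalIntegrable q volume 0 L)

/-- The Volterra operator with kernel `sin (ρ (x - t)) / ρ * q t`. -/
noncomputable def sineVolterra (ρ : ℂ) : C(Icc 0 L, ℂ) →L[ℂ] C(Icc 0 L, ℂ) :=
  (ContinuousLinearMap.mul ℂ C(Icc 0 L, ℂ) (sineMap L ρ)).comp
    ((weightedPrimitive hL hq).comp (ContinuousLinearMap.mul ℂ C(Icc 0 L, ℂ) (cosMap L ρ))) -
  (ContinuousLinearMap.mul ℂ C(Icc 0 L, ℂ) (cosMap L ρ)).comp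
    ((weightedPrimitive hL hq).comp (ContinuousLinearMap.mul ℂ C(Icc 0 L, ℂ) (sineMap L ρ)))

theorem sineVolterra_apply (ρ : ℂ) (f : C(Icc 0 L, ℂ)) (x : Icc 0 L) :
    sineVolterra hL hq ρ f x =
      ∫ t in 0..(x : ℝ), sineKernel ρ (x - t) * (q t * IccExtend hL f t) := by
  have hsub : uIcc 0 (x : ℝ) ⊆ uIcc 0 L :=
    uIcc_subset_uIcc_left (by rw [uIcc_of_le hL]; exact x.2)
  change sineKernel ρ x * (∫ t in 0..(x : ℝ), q t * IccExtend hL (cosMap L ρ * f) t) -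
    Complex.cos (ρ * (x : ℝ)) * (∫ t in 0..(x : ℝ), q t * IccExtend hL (sineMap L ρ * f) t) = _
  rw [← intervalIntegral.integral_const_mul, ← intervalIntegral.integral_const_mul,
    ← intervalIntegral.integral_sub
      (((intervalIntegrable_mul_IccExtend hL hq _).mono_set hsub).const_mul _)
      (((intervalIntegrable_mul_IccExtend hL hq _).mono_set hsub).const_mul _)]
  refine intervalIntegral.integral_congr fun t ht => ?_
  rw [uIcc_of_le x.2.1] at ht
  have ht' : t ∈ Icc 0 L := ⟨ht.1, ht.2.trans x.2.2⟩
  simp only [IccExtend_of_mem hL _ ht', sineKernel_sub, ContinuousMap.mul_apply]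
  change sineKernel ρ x * (q t * (Complex.cos (ρ * t) * f ⟨t, ht'⟩)) -
    Complex.cos (ρ * x) * (q t * (sineKernel ρ t * f ⟨t, ht'⟩)) = _
  ring

theorem differentiable_sineVolterra : Differentiable ℂ (sineVolterra hL hq) := by
  exact differentiable_mul_comp_mul_sub _ (differentiable_sineMap hL) (differentiable_cosMap L)

/-- The primitive `σ` of `‖q‖` is absolutely continuous, so `σ ^ (k + 1)` may be integrated from its
almost everywhere derivative. This produces the factorials in the iterated estimate. -/
theorem integral_norm_mul_pow_primitive {q : ℝ → ℂ} {L : ℝ} (hL : 0 ≤ L)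
    (hq : IntervalIntegrable q volume 0 L) {x : ℝ} (hx : x ∈ Icc 0 L) (k : ℕ) :
    ∫ t in 0..x, ‖q t‖ * (∫ u in 0..t, ‖q u‖) ^ k = (∫ u in 0..x, ‖q u‖) ^ (k + 1) / (k + 1) := by
  have hqc : IntervalIntegrable (fun t => ((‖q t‖ : ℝ) : ℂ)) volume 0 L := ⟨hq.norm.1.ofReal, hq.norm.2.ofReal⟩
  set σ : ℝ → ℂ := fun x => ∫ t in 0..x, ((‖q t‖ : ℝ) : ℂ) with hσ
  have hσac : AbsolutelyContinuousOnInterval σ 0 L := hqc.absolutelyContinuousOnInterval_integral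
  have hpow : ∀ n : ℕ, AbsolutelyContinuousOnInterval (fun x => σ x ^ (n + 1)) 0 L := fun n => by
    induction n with
    | zero => simpa using hσac
    | succ n ih => simpa [pow_succ] using ih.fun_smul hσac
  have hint : IntervalIntegrable (fun t => (k + 1 : ℂ) * (((‖q t‖ : ℝ) : ℂ) * σ t ^ k))
      volume 0 L :=
    (hqc.mul_continuousOn (hσac.continuousOn.pow k)).const_mul _
  have hd : ∀ᵐ x ∂volume.restrict (Ioo 0 L), HasDerivAt (fun x => σ x ^ (k + 1))
      ((k + 1 : ℂ) * (((‖q x‖ : ℝ) : ℂ) * σ x ^ k)) x := by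
    rw [ae_restrict_iff' measurableSet_Ioo]
    filter_upwards [hqc.ae_hasDerivAt_integral] with x hx1 hx
    have hx' : x ∈ uIcc 0 L := by rw [uIcc_of_le hL]; exact Ioo_subset_Icc_self hx
    refine ((hx1 hx' 0 left_mem_uIcc).pow (k + 1)).congr_deriv ?_
    simp only [Nat.add_sub_cancel, hσ]
    push_cast
    ring
  have h := (hpow k).sub_eq_integral hL hint hd hx
  have hreal : ∀ t, σ t = ((∫ u in 0..t, ‖q u‖ : ℝ) : ℂ) := fun t =>
    intervalIntegral.integral_ofReal
  rw [intervalIntegral.integral_const_mul] at h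
  simp only [hreal, intervalIntegral.integral_same] at h
  have h2 : ∀ t : ℝ, ((‖q t‖ : ℝ) : ℂ) * ((∫ u in 0..t, ‖q u‖ : ℝ) : ℂ) ^ k =
      ((‖q t‖ * (∫ u in 0..t, ‖q u‖) ^ k : ℝ) : ℂ) := fun t => by push_cast; rfl
  simp only [h2] at h
  rw [intervalIntegral.integral_ofReal] at h
  rw [eq_div_iff (by positivity)]
  have h3 : (∫ u in 0..x, ‖q u‖) ^ (k + 1) =
      (k + 1) * ∫ t in 0..x, ‖q t‖ * (∫ u in 0..t, ‖q u‖) ^ k := by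
    apply Complex.ofReal_injective
    push_cast
    simpa using h
  rw [h3]; ring

theorem norm_sineVolterra_pow_apply_le (ρ : ℂ) {M : ℝ}
    (hM : ∀ x ∈ Icc 0 L, ‖sineKernel ρ x‖ ≤ M) (f : C(Icc 0 L, ℂ)) (k : ℕ) (x : Icc 0 L) :
    ‖(sineVolterra hL hq ρ ^ k) f x‖ ≤
      ‖f‖ * (M * ∫ u in 0..(x : ℝ), ‖q u‖) ^ k / k.factorial := by
  have hM0 : 0 ≤ M := (norm_nonneg _).trans (hM 0 ⟨le_rfl, hL⟩)
  induction k generalizing x with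
  | zero => simpa using f.norm_coe_le_norm x
  | succ k ih =>
    rw [pow_succ', mul_apply_eq_comp, sineVolterra_apply]
    have hsub : uIcc 0 (x : ℝ) ⊆ uIcc 0 L :=
      uIcc_subset_uIcc_left (by rw [uIcc_of_le hL]; exact x.2)
    have hσ : ContinuousOn (fun t => ∫ u in 0..t, ‖q u‖) (uIcc 0 (x : ℝ)) :=
      (hq.norm.absolutelyContinuousOnInterval_intervalIntegral left_mem_uIcc).continuousOn.mono hsub
    have hi : IntervalIntegrable (fun t => ‖q t‖ * (∫ u in 0..t, ‖q u‖) ^ k) volume 0 x :=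
      (hq.norm.mono_set hsub).mul_continuousOn (hσ.pow k)
    calc _ ≤ ∫ t in 0..(x : ℝ), ‖f‖ * M ^ (k + 1) / k.factorial *
          (‖q t‖ * (∫ u in 0..t, ‖q u‖) ^ k) := by
          refine intervalIntegral.norm_integral_le_of_norm_le x.2.1 (ae_of_all _ fun t ht => ?_)
            (hi.const_mul _)
          have ht' : t ∈ Icc 0 L := ⟨ht.1.le, ht.2.trans x.2.2⟩
          rw [norm_mul, norm_mul, IccExtend_of_mem hL _ ht']
          have h1 := hM (x - t) ⟨sub_nonneg.2 ht.2, by linarith [x.2.2, ht.1]⟩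
          calc _ ≤ M * (‖q t‖ * (‖f‖ * (M * ∫ u in 0..t, ‖q u‖) ^ k / k.factorial)) := by
                gcongr
                exact ih ⟨t, ht'⟩
            _ = _ := by rw [mul_pow]; ring
      _ = _ := by
          rw [intervalIntegral.integral_const_mul, integral_norm_mul_pow_primitive hL hq x.2,
            mul_pow, Nat.factorial_succ]
          push_cast
          field_simp

/-- The norms of the powers decay like `a ^ k / k!`, so some power has norm below 1 however large
`q` and `ρ` are. -/
theorem isUnit_one_sub_sineVolterra (ρ : ℂ) : IsUnit (1 - sineVolterra hL hq ρ) := by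
  set T := sineVolterra hL hq ρ
  have hM : ∀ x ∈ Icc 0 L, ‖sineKernel ρ x‖ ≤ Real.exp (|ρ.im| * L) * L := fun x hx => by
    refine (norm_sineKernel_le ρ hx.1).trans ?_
    have := hx.2
    have := hx.1
    gcongr
  set M := Real.exp (|ρ.im| * L) * L
  have hM0 : 0 ≤ M := by positivity
  set a := M * ∫ u in 0..L, ‖q u‖
  have hσ0 : 0 ≤ ∫ u in 0..L, ‖q u‖ := intervalIntegral.integral_nonneg hL fun _ _ => norm_nonneg _
  have ha : 0 ≤ a := by positivity
  have hk : ∀ k : ℕ, ‖T ^ k‖ ≤ a ^ k / k.factorial := fun k =>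
    ContinuousLinearMap.opNorm_le_bound _ (by positivity) fun f => by
      refine (ContinuousMap.norm_le _ (by positivity)).2 fun x => ?_
      refine (norm_sineVolterra_pow_apply_le hL hq ρ hM f k x).trans ?_
      have h1 : 0 ≤ ∫ u in 0..(x : ℝ), ‖q u‖ :=
        intervalIntegral.integral_nonneg x.2.1 fun _ _ => norm_nonneg _
      have h2 : ∫ u in 0..(x : ℝ), ‖q u‖ ≤ ∫ u in 0..L, ‖q u‖ :=
        intervalIntegral.integral_mono_interval le_rfl x.2.1 x.2.2
            (ae_of_all _ fun _ => norm_nonneg _) hq.norm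
      have h3 : M * ∫ u in 0..(x : ℝ), ‖q u‖ ≤ a := mul_le_mul_of_nonneg_left h2 hM0
      calc _ ≤ ‖f‖ * a ^ k / k.factorial := by gcongr
        _ = _ := by ring
  obtain ⟨k, hk1⟩ := ((FloorSemiring.tendsto_pow_div_factorial_atTop a).eventually_lt_const
    one_pos).exists
  exact ContinuousLinearMap.isUnit_one_sub_of_norm_pow_lt_one ((hk k).trans_lt hk1)

/-- The sine-type solution as a continuous function on `[0, L]`. -/
noncomputable def sineSolutionMap (ρ : ℂ) : C(Icc 0 L, ℂ) :=
  Ring.inverse (1 - sineVolterra hL hq ρ) (sineMap L ρ)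

theorem differentiable_sineSolutionMap : Differentiable ℂ (sineSolutionMap hL hq) :=
  differentiable_inverse_one_sub_apply (differentiable_sineVolterra hL hq)
    (isUnit_one_sub_sineVolterra hL hq) (differentiable_sineMap hL)

theorem isVolterraSolution_sineSolutionMap (ρ : ℂ) :
    IsVolterraSolution q L ρ (IccExtend hL (sineSolutionMap hL hq ρ)) := by
  refine ⟨((sineSolutionMap hL hq ρ).continuous.Icc_extend' (h := hL)).continuousOn,
    fun x hx => ?_⟩
  have h1 := Ring.mul_inverse_cancel _ (isUnit_one_sub_sineVolterra hL hq ρ)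
  have h2 := congrArg (fun T : C(Icc 0 L, ℂ) →L[ℂ] C(Icc 0 L, ℂ) => T (sineMap L ρ) ⟨x, hx⟩) h1
  rw [IccExtend_of_mem hL _ hx]
  have h3 := sineVolterra_apply hL hq ρ (sineSolutionMap hL hq ρ) ⟨x, hx⟩
  simp only at h3
  rw [← h3]
  change sineSolutionMap hL hq ρ ⟨x, hx⟩ -
    sineVolterra hL hq ρ (sineSolutionMap hL hq ρ) ⟨x, hx⟩ = sineKernel ρ x at h2
  rw [← h2]; ring

theorem IsVolterraSolution.eq_sineSolutionMap {ρ : ℂ} {y : ℝ → ℂ}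
    (h : IsVolterraSolution q L ρ y) {x : ℝ} (hx : x ∈ Icc 0 L) :
    y x = sineSolutionMap hL hq ρ ⟨x, hx⟩ := by
  let f : C(Icc 0 L, ℂ) := ⟨fun x => y x, continuousOn_iff_continuous_domRestrict.1 h.1⟩
  have hf : (1 - sineVolterra hL hq ρ) f = sineMap L ρ := by
    ext z
    change y z - sineVolterra hL hq ρ f z = sineKernel ρ z
    rw [sineVolterra_apply, h.2 z z.2, sub_eq_iff_eq_add]
    congr 1
    refine intervalIntegral.integral_congr fun t ht => ?_
    rw [uIcc_of_le z.2.1] at ht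
    simp only [IccExtend_of_mem hL _ (show t ∈ Icc 0 L from ⟨ht.1, ht.2.trans z.2.2⟩)]
    rfl
  have h1 := Ring.inverse_mul_cancel _ (isUnit_one_sub_sineVolterra hL hq ρ)
  have h2 := congrArg (fun T : C(Icc 0 L, ℂ) →L[ℂ] C(Icc 0 L, ℂ) => T f ⟨x, hx⟩) h1
  simp only [mul_apply_eq_comp, hf] at h2
  exact h2.symm

end Resolvent

/-! ### Analyticity and asymptotics of the solution. -/

theorem isSineSolution_solS {q : ℝ → ℂ} {L : ℝ} (hL : 0 < L)
    (hq : IntervalIntegrable q volume 0 L) (ρ : ℂ) : IsSineSolution q L ρ (solS q L ρ) :=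
  Classical.epsilon_spec ((isVolterraSolution_sineSolutionMap hL.le hq ρ).isSineSolution hL hq)

/-- The choice behind `solS` carries no regularity in `ρ`; uniqueness identifies its values on `[0,
L]` with the analytic resolvent formula. -/
theorem solS_eq_sineSolutionMap {q : ℝ → ℂ} {L : ℝ} (hL : 0 < L)
    (hq : IntervalIntegrable q volume 0 L) (ρ : ℂ) {x : ℝ} (hx : x ∈ Icc 0 L) :
    solS q L ρ x = sineSolutionMap hL.le hq ρ ⟨x, hx⟩ :=
  ((isSineSolution_solS hL hq ρ).isVolterraSolution hL.le hq).eq_sineSolutionMap hL.le hq hx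

theorem differentiable_solS {q : ℝ → ℂ} {L : ℝ} (hL : 0 < L)
    (hq : IntervalIntegrable q volume 0 L) {x : ℝ} (hx : x ∈ Icc 0 L) :
    Differentiable ℂ fun ρ => solS q L ρ x := by
  simp only [solS_eq_sineSolutionMap hL hq _ hx]
  exact (ContinuousMap.evalCLM ℂ (⟨x, hx⟩ : Icc 0 L)).differentiable.comp
    (differentiable_sineSolutionMap hL.le hq)

/-- The defining predicate sees only `ρ²`, so the same function is chosen for `ρ` and `-ρ`. -/
theorem solS_neg (q : ℝ → ℂ) (L : ℝ) (ρ : ℂ) (x : ℝ) : solS q L (-ρ) x = solS q L ρ x := by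
  simp only [solS, IsSineSolution, neg_sq]

/-- Let `M` be the maximum of `|y(x)| exp(-|im ρ| x)`. The integral equation gives `M ≤ 1/|ρ| +
Mσ/|ρ|`, and `2σ ≤ |ρ|` absorbs the last term, so `M ≤ 2/|ρ|`. A second use of the equation gives
the square; the 8 comes from `1 + |ρ| ≤ 2|ρ|`. -/
theorem norm_solS_sub_sineKernel_le_of_large {q : ℝ → ℂ} {L : ℝ} (hL : 0 < L)
    (hq : IntervalIntegrable q volume 0 L) {ρ : ℂ} (h1 : 1 ≤ ‖ρ‖)
    (h2 : 2 * ∫ t in 0..L, ‖q t‖ ≤ ‖ρ‖) :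
    ‖solS q L ρ L - sineKernel ρ L‖ ≤
      8 * (∫ t in 0..L, ‖q t‖) * Real.exp (|ρ.im| * L) / (1 + ‖ρ‖) ^ 2 := by
  set σ := ∫ t in 0..L, ‖q t‖
  have hσ0 : 0 ≤ σ := intervalIntegral.integral_nonneg hL.le fun _ _ => norm_nonneg _
  obtain ⟨hyc, hy⟩ := (isSineSolution_solS hL hq ρ).isVolterraSolution hL.le hq
  set y := solS q L ρ
  have hρ : 0 < ‖ρ‖ := by linarith
  obtain ⟨x₀, hx₀, hmax⟩ := isCompact_Icc.exists_isMaxOn (nonempty_Icc.2 hL.le)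
    (f := fun x => ‖y x‖ * Real.exp (-(|ρ.im| * x))) (by fun_prop)
  set M := ‖y x₀‖ * Real.exp (-(|ρ.im| * x₀)) with hM
  have hM0 : 0 ≤ M := by positivity
  have hyM : ∀ t ∈ Icc 0 L, ‖y t‖ ≤ M * Real.exp (|ρ.im| * t) := fun t ht => by
    have h3 : ‖y t‖ * Real.exp (-(|ρ.im| * t)) ≤ M := hmax ht
    rwa [Real.exp_neg, ← div_eq_mul_inv, div_le_iff₀ (Real.exp_pos _)] at h3
  have hker : ∀ x, 0 ≤ x → ‖sineKernel ρ x‖ ≤ Real.exp (|ρ.im| * x) / ‖ρ‖ := fun x hx => by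
    rw [le_div_iff₀ hρ, mul_comm]
    exact norm_mul_norm_sineKernel_le ρ hx
  have hdiff : ∀ x ∈ Icc 0 L,
      ‖y x - sineKernel ρ x‖ ≤ M * Real.exp (|ρ.im| * x) / ‖ρ‖ * σ := fun x hx => by
    have hsub : uIcc 0 x ⊆ uIcc 0 L := uIcc_subset_uIcc_left (by rwa [uIcc_of_le hL.le])
    rw [hy x hx, add_sub_cancel_left]
    calc _ ≤ ∫ t in 0..x, M * Real.exp (|ρ.im| * x) / ‖ρ‖ * ‖q t‖ := by
          refine intervalIntegral.norm_integral_le_of_norm_le hx.1 (ae_of_all _ fun t ht => ?_)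
            ((hq.mono_set hsub).norm.const_mul _)
          have h3 := hker (x - t) (sub_nonneg.2 ht.2)
          have h4 := hyM t ⟨ht.1.le, ht.2.trans hx.2⟩
          have h5 : Real.exp (|ρ.im| * x) = Real.exp (|ρ.im| * (x - t)) * Real.exp (|ρ.im| * t) := by
            rw [← Real.exp_add]; ring_nf
          rw [norm_mul, norm_mul]
          calc _ ≤ Real.exp (|ρ.im| * (x - t)) / ‖ρ‖ *
                (‖q t‖ * (M * Real.exp (|ρ.im| * t))) := by gcongr
            _ = _ := by rw [h5]; ring
      _ = M * Real.exp (|ρ.im| * x) / ‖ρ‖ * ∫ t in 0..x, ‖q t‖ :=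
          intervalIntegral.integral_const_mul _ _
      _ ≤ _ := by
          gcongr
          exact intervalIntegral.integral_mono_interval le_rfl hx.1 hx.2
            (ae_of_all _ fun _ => norm_nonneg _) hq.norm
  have hMle : M ≤ 2 / ‖ρ‖ := by
    have h3 : ‖y x₀‖ ≤ Real.exp (|ρ.im| * x₀) / ‖ρ‖ +
        M * Real.exp (|ρ.im| * x₀) / ‖ρ‖ * σ := by
      have h4 := norm_add_le (sineKernel ρ x₀) (y x₀ - sineKernel ρ x₀)
      rw [add_sub_cancel] at h4
      exact h4.trans (add_le_add (hker x₀ hx₀.1) (hdiff x₀ hx₀))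
    have h5 : M ≤ 1 / ‖ρ‖ + M / ‖ρ‖ * σ := by
      have h7 : Real.exp (|ρ.im| * x₀) * Real.exp (-(|ρ.im| * x₀)) = 1 := by
        rw [← Real.exp_add, add_neg_cancel, Real.exp_zero]
      refine (mul_le_mul_of_nonneg_right h3 (Real.exp_pos (-(|ρ.im| * x₀))).le).trans_eq ?_
      linear_combination (1 / ‖ρ‖ + M / ‖ρ‖ * σ) * h7
    rw [le_div_iff₀ hρ]
    have h6 : M * ‖ρ‖ ≤ 1 + M * σ := by
      have := mul_le_mul_of_nonneg_right h5 hρ.le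
      refine this.trans_eq ?_
      field_simp
    nlinarith
  refine (hdiff L ⟨hL.le, le_rfl⟩).trans ?_
  calc _ ≤ 2 / ‖ρ‖ * Real.exp (|ρ.im| * L) / ‖ρ‖ * σ := by gcongr
    _ = 8 * σ * Real.exp (|ρ.im| * L) / (2 * ‖ρ‖) ^ 2 := by field_simp; ring
    _ ≤ _ := by
      gcongr
      linarith

theorem exists_norm_solS_sub_sineKernel_le {q : ℝ → ℂ} {L : ℝ} (hL : 0 < L)
    (hq : IntervalIntegrable q volume 0 L) : ∃ C : ℝ, 0 ≤ C ∧ ∀ ρ,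
      ‖solS q L ρ L - sineKernel ρ L‖ ≤ C * Real.exp (|ρ.im| * L) / (1 + ‖ρ‖) ^ 2 := by
  have hLm : L ∈ Icc 0 L := ⟨hL.le, le_rfl⟩
  set σ := ∫ t in 0..L, ‖q t‖ with hσ
  have hσ0 : 0 ≤ σ := intervalIntegral.integral_nonneg hL.le fun _ _ => norm_nonneg _
  have hsine : Differentiable ℂ fun ρ => sineKernel ρ L := by
    change Differentiable ℂ (ContinuousMap.evalCLM ℂ (⟨L, hLm⟩ : Icc 0 L) ∘ sineMap L)
    exact (ContinuousMap.evalCLM ℂ (⟨L, hLm⟩ : Icc 0 L)).differentiable.comp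
      (differentiable_sineMap hL.le)
  obtain ⟨B, hB⟩ := (isCompact_closedBall (0 : ℂ) (1 + 2 * σ)).exists_bound_of_continuousOn
    ((differentiable_solS hL hq hLm).sub hsine).continuous.continuousOn
  have hB0 : 0 ≤ B := (norm_nonneg _).trans (hB 0 (by simp; positivity))
  refine ⟨8 * σ + B * (2 + 2 * σ) ^ 2, by positivity, fun ρ => ?_⟩
  rcases le_total (1 + 2 * σ) ‖ρ‖ with h | h
  · refine (norm_solS_sub_sineKernel_le_of_large hL hq (by linarith) (by linarith)).trans ?_
    gcongr
    linarith [show 0 ≤ B * (2 + 2 * σ) ^ 2 by positivity]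
  · refine (hB ρ (by simpa using h)).trans ?_
    rw [le_div_iff₀ (by positivity)]
    have h1 : 1 ≤ Real.exp (|ρ.im| * L) := Real.one_le_exp (by positivity)
    calc _ ≤ B * (2 + 2 * σ) ^ 2 * 1 := by
          rw [mul_one]
          refine mul_le_mul_of_nonneg_left (pow_le_pow_left₀ (by positivity) (by linarith) 2) hB0
      _ ≤ _ := by
          gcongr
          linarith

/-! ### The truncated series as an interpolation sum. -/

theorem mul_csinc (w : ℂ) : Real.pi * w * csinc w = Complex.sin (Real.pi * w) := by
  have hpi : (Real.pi : ℂ) ≠ 0 := Complex.ofReal_ne_zero.2 Real.pi_ne_zero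
  unfold csinc
  split_ifs with h
  · simp [h]
  · field_simp

theorem csinc_zero : csinc 0 = 1 := if_pos rfl

/-- The sum of shifted cardinal sines in terms of the entire quotient of the cosine. -/
theorem csinc_add_csinc (n : ℕ) (z : ℂ) :
    csinc (2 * z / Real.pi - 2 * n - 1) + csinc (2 * z / Real.pi + 2 * n + 1) =
      -(2 * z * Complex.sin z * cosQuot n z) := by
  have hpi : (Real.pi : ℂ) ≠ 0 := Complex.ofReal_ne_zero.2 Real.pi_ne_zero
  have ha0 : (cosNode n : ℂ) ≠ 0 :=
    Complex.ofReal_ne_zero.2 (by linarith [one_lt_cosNode n])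
  have ha : (cosNode n : ℂ) = n * Real.pi + Real.pi / 2 := by unfold cosNode; push_cast; rfl
  have h1 : Real.pi * (2 * z / Real.pi - 2 * n - 1) = 2 * (z - cosNode n) := by
    rw [ha]; field_simp; ring
  have h2 : Real.pi * (2 * z / Real.pi + 2 * n + 1) = 2 * (z + cosNode n) := by
    rw [ha]; field_simp; ring
  -- Both shifts give `-sin 2z`, so away from the nodes the identity reduces to `1/(z-a) + 1/(z+a) =
  -- 2z/(z²-a²)`. At `z = ±a` one `csinc` takes its value 1 and the other vanishes.
  have hs1 : Complex.sin (2 * (z - cosNode n)) = -(2 * Complex.sin z * Complex.cos z) := by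
    rw [Complex.sin_two_mul, Complex.sin_sub, Complex.cos_sub, cos_cosNode]
    have := Complex.sin_sq_add_cos_sq (cosNode n : ℂ)
    rw [cos_cosNode] at this
    linear_combination -(2 * Complex.sin z * Complex.cos z) * this
  have hs2 : Complex.sin (2 * (z + cosNode n)) = -(2 * Complex.sin z * Complex.cos z) := by
    rw [Complex.sin_two_mul, Complex.sin_add, Complex.cos_add, cos_cosNode]
    have := Complex.sin_sq_add_cos_sq (cosNode n : ℂ)
    rw [cos_cosNode] at this
    linear_combination -(2 * Complex.sin z * Complex.cos z) * this
  have e1 := mul_csinc (2 * z / Real.pi - 2 * n - 1)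
  have e2 := mul_csinc (2 * z / Real.pi + 2 * n + 1)
  rw [h1, hs1] at e1
  rw [h2, hs2] at e2
  have hself := cosQuot_cosNode_self n
  have hsq : ((-1 : ℂ) ^ n) * (-1) ^ n = 1 := by rw [← mul_pow]; simp
  by_cases hz1 : z = cosNode n
  · have hw : 2 * z / Real.pi - 2 * n - 1 = 0 :=
      (mul_eq_zero.1 (h1.trans (by rw [hz1, sub_self, mul_zero]))).resolve_left hpi
    have hc2 : csinc (2 * z / Real.pi + 2 * n + 1) = 0 := by
      rw [hz1, cos_cosNode, mul_zero, neg_zero] at e2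
      rw [hz1]
      refine (mul_eq_zero.1 e2).resolve_left fun h => ha0 ?_
      linear_combination h / 4
    rw [hc2, hw, csinc_zero, hz1, sin_cosNode]
    linear_combination (-1) ^ n * hself - hsq
  · by_cases hz2 : z = -cosNode n
    · have hw : 2 * z / Real.pi + 2 * n + 1 = 0 :=
        (mul_eq_zero.1 (h2.trans (by rw [hz2, neg_add_cancel, mul_zero]))).resolve_left hpi
      have hc1 : csinc (2 * z / Real.pi - 2 * n - 1) = 0 := by
        rw [hz2, Complex.cos_neg, cos_cosNode, mul_zero, neg_zero] at e1
        rw [hz2]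
        refine (mul_eq_zero.1 e1).resolve_left fun h => ha0 ?_
        linear_combination -h / 4
      rw [hc1, hw, csinc_zero, hz2, Complex.sin_neg, sin_cosNode, cosQuot_neg]
      linear_combination (-1) ^ n * hself - hsq
    · have hm : z - cosNode n ≠ 0 := sub_ne_zero.2 hz1
      have hp : z + cosNode n ≠ 0 := fun h => hz2 (eq_neg_of_add_eq_zero_left h)
      have hQ := mul_cosQuot n z
      have hne : z ^ 2 - (cosNode n : ℂ) ^ 2 ≠ 0 := by
        rw [show z ^ 2 - (cosNode n : ℂ) ^ 2 = (z - cosNode n) * (z + cosNode n) by ring]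
        exact mul_ne_zero hm hp
      refine mul_left_cancel₀ hne ?_
      linear_combination (z + cosNode n) / 2 * e1 + (z - cosNode n) / 2 * e2 +
        2 * z * Complex.sin z * hQ

/-- The truncated cardinal series written without removable singularities. -/
noncomputable def truncSum (q : ℝ → ℂ) (L : ℝ) (N : ℕ) (ρ : ℂ) : ℂ :=
  sineKernel ρ L - ∑ n ∈ Finset.range N, L * cardinalCoeff q L n L * cosQuot n (ρ * L)

theorem differentiable_sineKernel {L : ℝ} (hL : 0 ≤ L) :
    Differentiable ℂ fun ρ => sineKernel ρ L := by
  change Differentiable ℂ (ContinuousMap.evalCLM ℂ (⟨L, hL, le_rfl⟩ : Icc 0 L) ∘ sineMap L)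
  exact (ContinuousMap.evalCLM ℂ _).differentiable.comp (differentiable_sineMap hL)

theorem differentiable_truncSum {q : ℝ → ℂ} {L : ℝ} (hL : 0 ≤ L) (N : ℕ) :
    Differentiable ℂ (truncSum q L N) := by
  refine (differentiable_sineKernel hL).sub (Differentiable.fun_sum fun n _ => ?_)
  exact ((differentiable_cosQuot n).comp (differentiable_id.mul_const _)).const_mul _

/-- The factor `2 z sin z` of `csinc_add_csinc` at `z = ρL` cancels the prefactor `1/(2ρ sin(ρL))`,
leaving an entire expression. -/
theorem truncSFormula_eq_truncSum (q : ℝ → ℂ) (L : ℝ) (N : ℕ) {ρ : ℂ}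
    (h : ρ * Complex.sin (ρ * L) ≠ 0) : truncSFormula q L N ρ L = truncSum q L N ρ := by
  obtain ⟨hρ, hs⟩ := mul_ne_zero_iff.1 h
  unfold truncSFormula truncSum
  rw [sub_eq_add_neg, Finset.mul_sum, ← Finset.sum_neg_distrib]
  congr 1
  · rw [← mul_sineKernel]; field_simp
  · refine Finset.sum_congr rfl fun n _ => ?_
    rw [mul_assoc 2 ρ (L : ℂ), csinc_add_csinc]
    field_simp

/-- The zeros of `ρ sin(ρL)` are isolated, as it is nonzero at `π/(2L)`; continuity of `truncSum`
then identifies the limits. -/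
theorem truncS_eq_truncSum (q : ℝ → ℂ) {L : ℝ} (hL : 0 < L) (N : ℕ) (ρ : ℂ) :
    truncS q L N ρ L = truncSum q L N ρ := by
  unfold truncS
  split_ifs with h
  · have hd : Differentiable ℂ fun z : ℂ => z * Complex.sin (z * L) := by fun_prop
    have hw : (fun z : ℂ => z * Complex.sin (z * L)) ((Real.pi / 2 / L : ℝ) : ℂ) ≠ 0 := by
      have h1 : ((Real.pi / 2 / L : ℝ) : ℂ) * L = ((Real.pi / 2 : ℝ) : ℂ) := by
        rw [← Complex.ofReal_mul, div_mul_cancel₀ _ hL.ne']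
      have h2 : 0 < Real.pi / 2 / L := by have := Real.pi_pos; positivity
      simp only [h1]
      rw [← Complex.ofReal_sin, Real.sin_pi_div_two, Complex.ofReal_one, mul_one]
      exact Complex.ofReal_ne_zero.2 h2.ne'
    have hne : ∀ᶠ z in 𝓝[≠] ρ, z * Complex.sin (z * L) ≠ 0 :=
      (hd.analyticAt ρ).eventually_eq_zero_or_eventually_ne_zero.resolve_left fun h0 =>
        hd.analyticOrderAt_ne_top hw ρ (analyticOrderAt_eq_top.2 h0)
    have hlim : Tendsto (truncSum q L N) (𝓝[≠] ρ) (𝓝 (truncSum q L N ρ)) :=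
      (differentiable_truncSum hL.le N).continuous.continuousAt.mono_left nhdsWithin_le_nhds
    exact (hlim.congr' (hne.mono fun z hz => (truncSFormula_eq_truncSum q L N hz).symm)).limUnder_eq
  · exact truncSFormula_eq_truncSum q L N h

/-- The `-2` in the coefficient is the contribution of `q = 0`: at a node, `2 a (-1)^n` times the
sine kernel is `2L`. What remains is, up to sign, the interpolation coefficient of `d`. -/
theorem mul_cardinalCoeff (q : ℝ → ℂ) {L : ℝ} (hL : 0 < L) (n : ℕ) :
    (L : ℂ) * cardinalCoeff q L n L = 2 * cosNode n * (-1) ^ n *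
      (solS q L (cosNode n / L) L - sineKernel (cosNode n / L) L) := by
  have hL0 : (L : ℂ) ≠ 0 := Complex.ofReal_ne_zero.2 hL.ne'
  have ha0 : (cosNode n : ℂ) ≠ 0 :=
    Complex.ofReal_ne_zero.2 (by linarith [one_lt_cosNode n])
  have ha : (cosNode n : ℂ) = n * Real.pi + Real.pi / 2 := by unfold cosNode; push_cast; rfl
  have h1 : (2 * (n : ℂ) + 1) / (2 * L) * Real.pi = cosNode n / L := by
    rw [ha]; field_simp
  have h2 := mul_sineKernel (cosNode n / L) L
  rw [div_mul_cancel₀ _ hL0, sin_cosNode] at h2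
  have hsq : ((-1 : ℂ) ^ n) * (-1) ^ n = 1 := by rw [← mul_pow]; simp
  have h3 : (cosNode n : ℂ) * sineKernel (cosNode n / L) L = (-1) ^ n * L := by
    rw [← h2]; field_simp
  unfold cardinalCoeff
  rw [h1]
  have h4 : (L : ℂ) * ((-1) ^ n * (2 * n + 1) * Real.pi / L * solS q L (cosNode n / L) L - 2) =
      2 * cosNode n * (-1) ^ n * solS q L (cosNode n / L) L - 2 * L := by
    rw [ha]; field_simp
  rw [h4]
  linear_combination 2 * (-1) ^ n * h3 + 2 * L * hsq

/-- The truncated cardinal series converges to the solution uniformly with respect to the natural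
weight. -/
theorem exists_norm_solS_sub_truncSum_le {q : ℝ → ℂ} {L : ℝ} (hL : 0 < L)
    (hq : IntervalIntegrable q volume 0 L) {η : ℝ} (hη : 0 < η) :
    ∃ N₀ : ℕ, ∀ N, N₀ ≤ N → ∀ ρ, ‖solS q L ρ L - truncSum q L N ρ‖ ≤
      η * Real.exp (|ρ.im| * L) / (1 + ‖ρ‖) := by
  have hL0 : (L : ℂ) ≠ 0 := Complex.ofReal_ne_zero.2 hL.ne'
  obtain ⟨C, hC0, hC⟩ := exists_norm_solS_sub_sineKernel_le hL hq
  set d : ℂ → ℂ := fun z => solS q L (z / L) L - sineKernel (z / L) L with hd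
  have hdd : Differentiable ℂ d :=
    ((differentiable_solS hL hq ⟨hL.le, le_rfl⟩).sub (differentiable_sineKernel hL.le)).comp
      (differentiable_id.div_const _)
  have heven : ∀ z, d (-z) = d z := fun z => by
    simp only [hd, neg_div, solS_neg, sineKernel_neg]
  have hbound : ∀ z, ‖d z‖ ≤ C * (1 + L) ^ 2 * Real.exp |z.im| / (1 + ‖z‖) ^ 2 := fun z => by
    have h1 := hC (z / L)
    have h2 : |(z / L).im| * L = |z.im| := by
      rw [Complex.div_ofReal_im, abs_div, abs_of_pos hL, div_mul_cancel₀ _ hL.ne']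
    have h3 : ‖z / L‖ = ‖z‖ / L := by
      rw [norm_div, Complex.norm_real, Real.norm_of_nonneg hL.le]
    rw [h2, h3] at h1
    refine h1.trans ?_
    have h4 : 1 + ‖z‖ ≤ (1 + L) * (1 + ‖z‖ / L) := by
      have : (1 + L) * (1 + ‖z‖ / L) = 1 + ‖z‖ + L + ‖z‖ / L := by field_simp; ring
      rw [this]
      have : 0 ≤ ‖z‖ / L := by positivity
      linarith
    rw [div_le_div_iff₀ (by positivity) (by positivity)]
    calc _ ≤ C * Real.exp |z.im| * ((1 + L) * (1 + ‖z‖ / L)) ^ 2 := by gcongr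
      _ = _ := by ring
  -- The factor `1 + 1/L` pays for the rescaling `z = ρL`, through `1 + |ρ| ≤ (1 + 1/L)(1 + |ρ|L)`.
  obtain ⟨N₀, hN₀⟩ := exists_norm_sub_cardinalSum_le hdd heven hbound
    (δ := η / (1 + 1 / L)) (by positivity)
  refine ⟨N₀, fun N hN ρ => ?_⟩
  have h1 := hN₀ N hN (ρ * L)
  have h2 : d (ρ * L) - ∑ n ∈ Finset.range N,
      -(2 * cosNode n * (-1) ^ n * d (cosNode n)) * cosQuot n (ρ * L) =
      solS q L ρ L - truncSum q L N ρ := by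
    unfold truncSum
    simp only [mul_cardinalCoeff q hL, hd, mul_div_cancel_right₀ _ hL0, neg_mul,
      Finset.sum_neg_distrib]
    ring
  have h3 : |(ρ * L).im| = |ρ.im| * L := by rw [Complex.im_mul_ofReal, abs_mul, abs_of_pos hL]
  have h4 : ‖ρ * L‖ = ‖ρ‖ * L := by rw [norm_mul, Complex.norm_real, Real.norm_of_nonneg hL.le]
  rw [h2, h3, h4] at h1
  refine h1.trans ?_
  have h5 : 1 + ‖ρ‖ ≤ (1 + 1 / L) * (1 + ‖ρ‖ * L) := by
    have : (1 + 1 / L) * (1 + ‖ρ‖ * L) = 1 + ‖ρ‖ + ‖ρ‖ * L + 1 / L := by field_simp; ring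
    rw [this]
    have : 0 ≤ ‖ρ‖ * L + 1 / L := by positivity
    linarith
  rw [div_le_div_iff₀ (by positivity) (by positivity)]
  calc _ ≤ η / (1 + 1 / L) * Real.exp (|ρ.im| * L) * ((1 + 1 / L) * (1 + ‖ρ‖ * L)) := by gcongr
    _ = _ := by field_simp

theorem mainTheorem10 (L : ℝ) (hL : 0 < L) (q : ℝ → ℂ)
    (hq : MemLp q 2 (volume.restrict (Icc (0 : ℝ) L))) :
    Differentiable ℂ (fun ρ : ℂ => solS q L ρ L) ∧
    (∀ N : ℕ, Differentiable ℂ (fun ρ : ℂ => truncS q L N ρ L)) ∧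
    ∀ ε : ℝ, 0 < ε → ∃ N₀ : ℕ, ∀ N : ℕ, N₀ ≤ N →
      ∃ e : ZeroWithMultiplicity (fun ρ : ℂ => solS q L ρ L) ≃
          ZeroWithMultiplicity (fun ρ : ℂ => truncS q L N ρ L),
        ∀ p : ZeroWithMultiplicity (fun ρ : ℂ => solS q L ρ L),
          ‖p.point - (e p).point‖ ≤ ε := by
  have hqi : IntervalIntegrable q volume 0 L :=
    (intervalIntegrable_iff_integrableOn_Icc_of_le hL.le).2 (hq.integrable one_le_two)
  have hS := differentiable_solS hL hqi (x := L) ⟨hL.le, le_rfl⟩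
  have hT : ∀ N, (fun ρ : ℂ => truncS q L N ρ L) = truncSum q L N := fun N =>
    funext (truncS_eq_truncSum q hL N)
  refine ⟨hS, fun N => ?_, fun ε hε => ?_⟩
  · rw [hT]
    exact differentiable_truncSum hL.le N
  · obtain ⟨C, hC0, hC⟩ := exists_norm_solS_sub_sineKernel_le hL hqi
    obtain ⟨η, hη, hstab⟩ := exists_stability_zeros_of_sine_asymptotics hL hS (C := C)
      (fun ρ => by
        -- Multiplication by `ρ` costs one of the two powers of `1 + |ρ|` in the asymptotics.
        rw [← mul_sineKernel, ← mul_sub, norm_mul]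
        calc _ ≤ (1 + ‖ρ‖) * (C * Real.exp (|ρ.im| * L) / (1 + ‖ρ‖) ^ 2) := by
              gcongr
              · linarith
              · exact hC ρ
          _ = _ := by field_simp) hε
    obtain ⟨N₀, hN₀⟩ := exists_norm_solS_sub_truncSum_le hL hqi hη
    refine ⟨N₀, fun N hN => ?_⟩
    rw [hT]
    exact hstab _ (differentiable_truncSum hL.le N) (hN₀ N hN)
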